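/- \textbf{Setting.} Let $n\ge 0$ be the dimension, let $\Xi$ be a (standard Borel) noise space, $P$ a probability measure on $\Xi$, and $F:\mathbb R^n\times\Xi\to\mathbb R$ a Borel function such that $F(x,\cdot)$ is $P$-integrable for every $x$. Let $f(x)=\int_\Xi F(x,\xi)\,dP(\xi)$ be bounded below, with $f^*=\inf_{x\in\mathbb R^n} f(x)$. Let $L>0$, $\sigma\ge 0$, $\tilde D>0$ and $x_1\in\mathbb R^n$. Assume that, $P$-almost surely, $F(\cdot,\xi)$ is differentiable with $L$-Lipschitz gradient, and write $G(x,\xi)=\nabla_xF(x,\xi)$. Only values of $F$ are available: a call of the stochastic zeroth-order oracle with input $(x,\xi)$ returns $F(x,\xi)$. Put $D_f=[2(f(x_1)-f^*)/L]^{1/2}$ and, for integers $N\ge1$, $$\bar{\mathcal B}_N=\frac{12(n+4)LD_f^2}{N}+\frac{4\sigma\sqrt{n+4}}{\sqrt N}\Big(\tilde D+\frac{D_f^2}{\tilde D}\Big),\qquad \gamma_k=\frac1{\sqrt{n+4}}\min\Big\{\frac1{4L\sqrt{n+4}},\frac{\tilde D}{\sigma\sqrt N}\Big\}\quad(1\le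 k\le N),$$ where $\tilde D/(\sigma\sqrt N)=+\infty$ if $\sigma=0$. Let the smoothing parameter satisfy $0<\mu\le D_f/((n+4)\sqrt{2N})$ (so $D_f>0$), and let $G_\mu(x,\xi,u)=\frac{F(x+\mu u,\xi)-F(x,\xi)}{\mu}\,u$, which costs two oracle calls. \textbf{RSGF run.} Draw $R\in\{1,\dots,N\}$ with $\mathrm{Prob}\{R=k\}=\frac{\gamma_k-2L(n+4)\gamma_k^2}{\sum_{j=1}^N[\gamma_j-2L(n+4)\gamma_j^2]}$; for $k=1,\dots,R$ draw $\xi_k$ and $u_k$, compute $G_\mu(x_k,\xi_k,u_k)$ and set $x_{k+1}=x_k-\gamma_kG_\mu(x_k,\xi_k,u_k)$; output $x_R$. \textbf{2-RSGF method} with integers $S,N,T\ge1$. Optimization phase: $S$ RSGF runs from $x_1$ give $\bar x_1,\dots,\bar x_S$. Post-optimization phase: for every $s$ compute $g_\mu(\bar x_s)=\frac1T\sum_{k=1}^TG_\mu(\bar x_s,\xi_k,u_k)$ from new samples (which may or may not be shared by the different $s$), and output a candidate $\bar x^*\in\{\bar x_1,\dots,\bar x_S\}$ with $\|g_\mu(\bar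 x^*)\|=\min_s\|g_\mu(\bar x_s)\|$, ties being broken measurably in any way. \textbf{Sampling.} The history of a sample in a run consists of all previous runs and the previous samples of that run; the history of a sample in the post-optimization phase consists of the optimization phase and the previous samples for the same candidate. Every direction $u$ is an $n$-dimensional standard Gaussian vector, independent of its history together with the $\xi$ of the same iteration; every $R$ is independent of the previous runs and of the samples of its run. For every $\xi$, almost surely under its conditional law given its history, $F(\cdot,\xi)$ is differentiable with $L$-Lipschitz gradient, and, conditionally on the history, for all $x\in\mathbb R^n$ (expectations being finite): $\mathbb E[F(x,\xi)]=f(x)$, $\mathbb E[G(x,\xi)]=\nabla f(x)$ and $\mathbb E\|G(x,\xi)-\nabla f(x)\|^2\le\sigma^2$. (The $\xi$'s need not be independent of the past.) \textbf{Theorem.} (a) For all integers $S,N,T\ge1$ and all $\lambda>0$, $$\mathrm{Prob}\Big\{\|\nabla f(\bar x^*)\|^2\ge 8L\bar{\mathcal B}_N+\frac{3(n+4)L^2D_f^2}{2N}+\frac{24(n+4)\lambda}{T}\Big[L\bar{\mathcal B}_N+\frac{(n+4)L^2D_f^2}{N}+\sigma^2\Big]\Big\}\le\frac{S+1}{\lambda}+2^{-S}.$$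 (b) Let $\epsilon>0$ and $\Lambda\in(0,1)$, and let $S=S(\Lambda)=\lceil\log_2(2/\Lambda)\rceil$, $$N=\hat N(\epsilon)=\Big\lceil\max\Big\{\frac{12(n+4)(6LD_f)^2}{\epsilon},\Big[72L\sqrt{n+4}\Big(\tilde D+\frac{D_f^2}{\tilde D}\Big)\frac{\sigma}{\epsilon}\Big]^2\Big\}\Big\rceil,\qquad T=\hat T(\epsilon,\Lambda)=\Big\lceil\frac{24(n+4)(S+1)}{\Lambda}\max\Big\{1,\frac{6\sigma^2}{\epsilon}\Big\}\Big\rceil .$$ Then $\bar x^*$ is an $(\epsilon,\Lambda)$-solution, i.e. $\mathrm{Prob}\{\|\nabla f(\bar x^*)\|^2\le\epsilon\}\ge1-\Lambda$, and the method makes at most $2S(\Lambda)[\hat N(\epsilon)+\hat T(\epsilon,\Lambda)]$ oracle calls. -/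

import Mathlib

open MeasureTheory ProbabilityTheory

/-- The class `C_L^{1,1}`: differentiable with `L`-Lipschitz gradient. -/
def IsC11 {n : ℕ} (L : ℝ) (g : EuclideanSpace ℝ (Fin n) → ℝ) : Prop :=
  Differentiable ℝ g ∧ ∀ x y, ‖gradient g y - gradient g x‖ ≤ L * ‖y - x‖

/-- The objective `f(x) = ∫ F(x, ξ) dP(ξ)`. -/
noncomputable def objective {n : ℕ} {Ξ : Type*} [MeasurableSpace Ξ]
    (F : EuclideanSpace ℝ (Fin n) → Ξ → ℝ) (P : Measure Ξ) : EuclideanSpace ℝ (Fin n) → ℝ :=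
  fun x => ∫ ξ, F x ξ ∂P

/-- The oracle assumptions on a law `Q` of the noise `ξ`, at every input point `x`, where
`G(x, ξ)` is the gradient of `F(·, ξ)` at `x`. -/
structure OracleLaw {n : ℕ} {Ξ : Type*} [MeasurableSpace Ξ]
    (F : EuclideanSpace ℝ (Fin n) → Ξ → ℝ) (f : EuclideanSpace ℝ (Fin n) → ℝ)
    (L σ : ℝ) (Q : Measure Ξ) : Prop where
  /-- `F(·, ξ)` is almost surely of class `C_L^{1,1}`. -/
  smooth : ∀ᵐ ξ ∂Q, IsC11 L (fun x => F x ξ)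
  /-- The zeroth-order oracle is unbiased: `E[F(x, ξ)] = f(x)`. -/
  value_integrable : ∀ x, Integrable (F x) Q
  value_mean : ∀ x, ∫ ξ, F x ξ ∂Q = f x
  /-- The stochastic gradient is unbiased: `E[G(x, ξ)] = ∇ f(x)`. -/
  grad_integrable : ∀ x, Integrable (fun ξ => gradient (fun y => F y ξ) x) Q
  grad_mean : ∀ x, ∫ ξ, gradient (fun y => F y ξ) x ∂Q = gradient f x
  /-- `E[‖G(x, ξ) - ∇ f(x)‖²] ≤ σ²`. -/
  var_integrable : ∀ x, Integrable (fun ξ => ‖gradient (fun y => F y ξ) x - gradient f x‖ ^ 2) Q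
  var_le : ∀ x, ∫ ξ, ‖gradient (fun y => F y ξ) x - gradient f x‖ ^ 2 ∂Q ≤ σ ^ 2

/-! ### Algorithms with access to a zeroth-order oracle -/

/-- A procedure that sees `F` only through calls to the oracle: `ask x ξ next` submits the input
`(x, ξ)` and continues with `next (F x ξ)`. -/
inductive OracleProg (E Ξ α : Type*) where
  | ret (a : α) : OracleProg E Ξ α
  | ask (x : E) (ξ : Ξ) (next : ℝ → OracleProg E Ξ α) : OracleProg E Ξ α

namespace OracleProg

variable {E Ξ α β : Type*}

/-- Sequential composition. -/
def bind : OracleProg E Ξ α → (α → OracleProg E Ξ β) → OracleProg E Ξ β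
  | ret a, g => g a
  | ask x ξ next, g => ask x ξ (fun y => bind (next y) g)

/-- The output when the oracle returns the values of `F`. -/
def output (F : E → Ξ → ℝ) : OracleProg E Ξ α → α
  | ret a => a
  | ask x ξ next => output F (next (F x ξ))

/-- The number of oracle calls made when the oracle returns the values of `F`. -/
def calls (F : E → Ξ → ℝ) : OracleProg E Ξ α → ℕ
  | ret _ => 0
  | ask x ξ next => calls F (next (F x ξ)) + 1

/-- Run the procedures `p 0, …, p (m - 1)` one after another and collect their outputs. -/
def collect : (m : ℕ) → (Fin m → OracleProg E Ξ α) → OracleProg E Ξ (Fin m → α)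
  | 0, _ => ret Fin.elim0
  | m + 1, p => (p 0).bind fun a => (collect m fun i => p i.succ).bind fun b => ret (Fin.cons a b)

end OracleProg

/-- The estimator `G_μ(x, ξ, u) = ((F(x + μ u, ξ) - F(x, ξ)) / μ) u`, at two oracle calls. -/
noncomputable def gradEstimate {n : ℕ} {Ξ : Type*} (μ : ℝ) (x : EuclideanSpace ℝ (Fin n)) (ξ : Ξ)
    (u : EuclideanSpace ℝ (Fin n)) :
    OracleProg (EuclideanSpace ℝ (Fin n)) Ξ (EuclideanSpace ℝ (Fin n)) :=
  .ask (x + μ • u) ξ fun a => .ask x ξ fun b => .ret (((a - b) / μ) • u)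

/-- The first `k` iterations of the RSGF method; the output is the iterate `x_{k+1}`.
The `(k+1)`-st iteration uses `γ (k+1)` and the samples `ξ k`, `u k`. -/
noncomputable def rsgfSteps {n : ℕ} {Ξ : Type*} (γ : ℕ → ℝ) (μ : ℝ)
    (x₁ : EuclideanSpace ℝ (Fin n)) (ξ : ℕ → Ξ) (u : ℕ → EuclideanSpace ℝ (Fin n)) :
    ℕ → OracleProg (EuclideanSpace ℝ (Fin n)) Ξ (EuclideanSpace ℝ (Fin n))
  | 0 => .ret x₁
  | k + 1 => (rsgfSteps γ μ x₁ ξ u k).bind fun x =>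
      (gradEstimate μ x (ξ k) (u k)).bind fun g => .ret (x - γ (k + 1) • g)

/-- The RSGF method with iteration count `R ≥ 1`: iterations `1, …, R` are carried out, the last
one with its own call of the estimator, and the output is `x_R`. -/
noncomputable def rsgf {n : ℕ} {Ξ : Type*} (γ : ℕ → ℝ) (μ : ℝ) (x₁ : EuclideanSpace ℝ (Fin n))
    (ξ : ℕ → Ξ) (u : ℕ → EuclideanSpace ℝ (Fin n)) (R : ℕ) :
    OracleProg (EuclideanSpace ℝ (Fin n)) Ξ (EuclideanSpace ℝ (Fin n)) :=
  (rsgfSteps γ μ x₁ ξ u (R - 1)).bind fun x =>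
    (gradEstimate μ x (ξ (R - 1)) (u (R - 1))).bind fun _ => .ret x

/-- The averaged estimator `g_μ(x) = (1/T) ∑_k G_μ(x, ξ_k, u_k)`. -/
noncomputable def avgGradEstimate {n : ℕ} {Ξ : Type*} (μ : ℝ) (T : ℕ)
    (x : EuclideanSpace ℝ (Fin n)) (ξ : ℕ → Ξ) (u : ℕ → EuclideanSpace ℝ (Fin n)) :
    OracleProg (EuclideanSpace ℝ (Fin n)) Ξ (EuclideanSpace ℝ (Fin n)) :=
  (OracleProg.collect T fun k => gradEstimate μ x (ξ k) (u k)).bind fun g =>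
    .ret ((1 / (T : ℝ)) • ∑ k, g k)

/-- The random inputs of the two-phase method: `ξ s k`, `u s k` and the iteration count `R s` in
run `s` of the optimization phase; `ξ' s k`, `u' s k` in the post-optimization phase, for the
estimate at the candidate number `s`. Runs and samples are numbered from `0`, and only
`s < S`, `k < N` (respectively `k < T`) are used. -/
structure Draws (n : ℕ) (Ξ Ω : Type*) where
  ξ : ℕ → ℕ → Ω → Ξ
  u : ℕ → ℕ → Ω → EuclideanSpace ℝ (Fin n)
  R : ℕ → Ω → ℕ
  ξ' : ℕ → ℕ → Ω → Ξ
  u' : ℕ → ℕ → Ω → EuclideanSpace ℝ (Fin n)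

/-- The 2-RSGF method on the random inputs `d` at `ω`. The argument `pick` selects the index of
the output from the list of the averaged gradient estimates. -/
noncomputable def twoRSGF {n : ℕ} {Ξ Ω : Type*} (γ : ℕ → ℝ) (μ : ℝ)
    (x₁ : EuclideanSpace ℝ (Fin n)) (S T : ℕ) (d : Draws n Ξ Ω) (ω : Ω)
    (pick : (Fin S → EuclideanSpace ℝ (Fin n)) → Fin S) :
    OracleProg (EuclideanSpace ℝ (Fin n)) Ξ (EuclideanSpace ℝ (Fin n)) :=
  (OracleProg.collect S fun s =>
      rsgf γ μ x₁ (fun k => d.ξ s k ω) (fun k => d.u s k ω) (d.R s ω)).bind fun x =>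
    (OracleProg.collect S fun s =>
        avgGradEstimate μ T (x s) (fun k => d.ξ' s k ω) (fun k => d.u' s k ω)).bind fun g =>
      .ret (x (pick g))

/-- `pick` selects an index with the smallest norm; ties may be broken in any measurable way,
possibly at random. -/
structure IsMinNormPick {n : ℕ} {Ω : Type*} [MeasurableSpace Ω] {S : ℕ}
    (pick : Ω → (Fin S → EuclideanSpace ℝ (Fin n)) → Fin S) : Prop where
  measurable : Measurable (Function.uncurry pick)
  norm_le : ∀ (ω : Ω) (g : Fin S → EuclideanSpace ℝ (Fin n)) (s : Fin S), ‖g (pick ω g)‖ ≤ ‖g s‖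

/-! ### Parameters -/

/-- `D_f = (2 (f(x₁) - f^*) / L)^{1/2}` with `f^* = inf f`. -/
noncomputable def Dgap {n : ℕ} (f : EuclideanSpace ℝ (Fin n) → ℝ) (L : ℝ)
    (x₁ : EuclideanSpace ℝ (Fin n)) : ℝ :=
  √(2 * (f x₁ - ⨅ x, f x) / L)

/-- The constant stepsizes
`γ_k = (n+4)^{-1/2} min {1 / (4 L √(n+4)), D / (σ √N)}`, where `D / (σ √N)` is read as `+∞`
if `σ = 0`. -/
noncomputable def stepsize (n : ℕ) (L σ D : ℝ) (N : ℕ) : ℕ → ℝ := fun _ =>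
  1 / √((n : ℝ) + 4) *
    if σ = 0 then 1 / (4 * L * √((n : ℝ) + 4))
    else min (1 / (4 * L * √((n : ℝ) + 4))) (D / (σ * √(N : ℝ)))

/-- `P_R(k) = (γ_k - 2L(n+4)γ_k²) / ∑_{j=1}^N (γ_j - 2L(n+4)γ_j²)`. -/
noncomputable def probR (n : ℕ) (L : ℝ) (γ : ℕ → ℝ) (N k : ℕ) : ℝ :=
  (γ k - 2 * L * ((n : ℝ) + 4) * γ k ^ 2) /
    ∑ j ∈ Finset.Icc 1 N, (γ j - 2 * L * ((n : ℝ) + 4) * γ j ^ 2)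

/-- `B_N = 12 (n+4) L D_f² / N + (4 σ √(n+4) / √N) (D + D_f² / D)`. -/
noncomputable def Bbar (n : ℕ) (L σ D Df : ℝ) (N : ℕ) : ℝ :=
  12 * ((n : ℝ) + 4) * L * Df ^ 2 / N +
    4 * σ * √((n : ℝ) + 4) / √(N : ℝ) * (D + Df ^ 2 / D)

/-- `S(Λ) = ⌈log₂ (2 / Λ)⌉`. -/
noncomputable def numRuns (Λ : ℝ) : ℕ := ⌈Real.logb 2 (2 / Λ)⌉₊

/-- The iteration limit for accuracy `ε`. -/
noncomputable def Nhat (n : ℕ) (L σ D Df ε : ℝ) : ℕ :=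
  ⌈max (12 * ((n : ℝ) + 4) * (6 * L * Df) ^ 2 / ε)
    ((72 * L * √((n : ℝ) + 4) * (D + Df ^ 2 / D) * (σ / ε)) ^ 2)⌉₊

/-- The sample size for accuracy `ε` and confidence level `Λ`. -/
noncomputable def That (n : ℕ) (σ ε Λ : ℝ) : ℕ :=
  ⌈24 * ((n : ℝ) + 4) * ((numRuns Λ : ℝ) + 1) / Λ * max 1 (6 * σ ^ 2 / ε)⌉₊

/-! ### The sampling model -/

namespace Draws

variable {n : ℕ} {Ξ Ω : Type*}

/-- All samples and iteration counts of the runs numbered `0, …, s - 1`. -/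
def runsBefore (d : Draws n Ξ Ω) (N s : ℕ) (ω : Ω) :
    Fin s → (Fin N → Ξ × EuclideanSpace ℝ (Fin n)) × ℕ :=
  fun q => (fun j => (d.ξ q j ω, d.u q j ω), d.R q ω)

/-- What is known before iteration `k + 1` of run `s`: all earlier runs, and the first `k` samples
of this run. -/
def optHistory (d : Draws n Ξ Ω) (N s k : ℕ) (ω : Ω) :
    (Fin s → (Fin N → Ξ × EuclideanSpace ℝ (Fin n)) × ℕ) ×
      (Fin k → Ξ × EuclideanSpace ℝ (Fin n)) :=
  (d.runsBefore N s ω, fun j => (d.ξ s j ω, d.u s j ω))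

/-- What is known before sample `k + 1` of the estimate at candidate `s`: the optimization phase,
and the first `k` samples of this estimate. -/
def postHistory (d : Draws n Ξ Ω) (S N s k : ℕ) (ω : Ω) :
    (Fin S → (Fin N → Ξ × EuclideanSpace ℝ (Fin n)) × ℕ) ×
      (Fin k → Ξ × EuclideanSpace ℝ (Fin n)) :=
  (d.runsBefore N S ω, fun j => (d.ξ' s j ω, d.u' s j ω))

/-- The joint law of the random inputs of the 2-RSGF method. The noise `ξ` need not be independent
of the past: the oracle assumptions are imposed on its conditional law given the history. They
hold in particular if the `ξ`'s are independent of each other and of everything else with a common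
law that satisfies `OracleLaw`. In the post-optimization phase nothing is assumed on the joint law
of the samples for different candidates, so that the same samples may serve all of them. -/
structure IsSampling [MeasurableSpace Ξ] [StandardBorelSpace Ξ] [Nonempty Ξ] [MeasurableSpace Ω]
    (d : Draws n Ξ Ω) (Pr : Measure Ω) [IsFiniteMeasure Pr]
    (F : EuclideanSpace ℝ (Fin n) → Ξ → ℝ) (f : EuclideanSpace ℝ (Fin n) → ℝ)
    (L σ : ℝ) (γ : ℕ → ℝ) (S N T : ℕ) : Prop where
  measurable_ξ : ∀ s k, Measurable (d.ξ s k)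
  measurable_u : ∀ s k, Measurable (d.u s k)
  measurable_R : ∀ s, Measurable (d.R s)
  measurable_ξ' : ∀ s k, Measurable (d.ξ' s k)
  measurable_u' : ∀ s k, Measurable (d.u' s k)
  /-- The oracle assumptions, conditionally on the history. -/
  oracle : ∀ s < S, ∀ k < N, ∀ᵐ h ∂(Pr.map (d.optHistory N s k)),
    OracleLaw F f L σ (condDistrib (d.ξ s k) (d.optHistory N s k) Pr h)
  oracle' : ∀ s < S, ∀ k < T, ∀ᵐ h ∂(Pr.map (d.postHistory S N s k)),
    OracleLaw F f L σ (condDistrib (d.ξ' s k) (d.postHistory S N s k) Pr h)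
  /-- The directions are standard Gaussian, independent of the history and of the noise. -/
  gaussian : ∀ s < S, ∀ k < N, Pr.map (d.u s k) = stdGaussian (EuclideanSpace ℝ (Fin n))
  gaussian_indep : ∀ s < S, ∀ k < N,
    IndepFun (d.u s k) (fun ω => (d.optHistory N s k ω, d.ξ s k ω)) Pr
  gaussian' : ∀ s < S, ∀ k < T, Pr.map (d.u' s k) = stdGaussian (EuclideanSpace ℝ (Fin n))
  gaussian_indep' : ∀ s < S, ∀ k < T,
    IndepFun (d.u' s k) (fun ω => (d.postHistory S N s k ω, d.ξ' s k ω)) Pr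
  /-- The iteration counts have mass function `P_R` on `{1, …, N}` and are independent of the
  earlier runs and of the samples of their run. -/
  R_mem : ∀ s < S, ∀ ω, d.R s ω ∈ Finset.Icc 1 N
  R_law : ∀ s < S, ∀ k ∈ Finset.Icc 1 N, Pr.real {ω | d.R s ω = k} = probR n L γ N k
  R_indep : ∀ s < S, IndepFun (d.R s) (d.optHistory N s N) Pr

end Draws

/-- A random point `X` is an `(ε, Λ)`-solution: `P{‖∇f(X)‖² ≤ ε} ≥ 1 - Λ`. -/
def IsEpsLamSolution {n : ℕ} {Ω : Type*} [MeasurableSpace Ω] (Pr : Measure Ω)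
    (f : EuclideanSpace ℝ (Fin n) → ℝ) (ε Λ : ℝ) (X : Ω → EuclideanSpace ℝ (Fin n)) : Prop :=
  1 - Λ ≤ Pr.real {ω | ‖gradient f (X ω)‖ ^ 2 ≤ ε}

/-!
Gaussian smoothing turns `f` into `f_μ`, with `∇f_μ(x) = 𝔼[(f (x + μu) - f x) / μ • u]`. Hence each
two-point estimate `G_μ` is conditionally unbiased for `∇f_μ`, while `‖∇f_μ - ∇f‖²` is at most a
`smoothingError` of order `μ²` and the conditional second moment of `G_μ` is at most
`2(n + 4)‖∇f‖²` plus a `noiseLevel`. The descent inequality along a run, summed over the steps and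
weighted by the law of `R`, bounds `𝔼‖∇f(x_R)‖²` by `L * Bbar`, even conditionally on the previous
runs.

By Markov's inequality, conditionally on the previous runs each candidate has
`‖∇f‖² ≥ 2L * Bbar` with probability at most `1/2`, so all `S` candidates are this bad with
probability at most `2 ^ (-S)`. The errors of the averaged estimates are martingale differences
around `∇f_μ`, so Chebyshev's inequality makes every average accurate outside an event of
probability `O(S / T)`. If some candidate is good and every average is accurate, then so is the
candidate whose average has the smallest norm.
-/

section GaussianMoments

open Module
open scoped RealInnerProductSpace

variable {E : Type*} [NormedAddCommGroup E] [InnerProductSpace ℝ E]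

/-- The density of the standard Gaussian measure with respect to the Lebesgue measure. -/
noncomputable def stdGaussianDensity (u : E) : ℝ :=
  (2 * Real.pi) ^ (-(finrank ℝ E : ℝ) / 2) * Real.exp (-(1 / 2) * ‖u‖ ^ 2)

lemma stdGaussianDensity_nonneg (u : E) : 0 ≤ stdGaussianDensity u := by
  unfold stdGaussianDensity; positivity

lemma continuous_stdGaussianDensity : Continuous (stdGaussianDensity (E := E)) := by
  unfold stdGaussianDensity; fun_prop

lemma hasLineDerivAt_stdGaussianDensity (a u : E) :
    HasLineDerivAt ℝ stdGaussianDensity (-(⟪a, u⟫ * stdGaussianDensity u)) u a := by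
  have hsq := ((hasStrictFDerivAt_norm_sq u).hasFDerivAt.hasLineDerivAt a).const_mul (-(1 / 2 : ℝ))
  have hexp := hsq.exp.const_mul ((2 * Real.pi) ^ (-(finrank ℝ E : ℝ) / 2))
  refine hexp.congr_deriv ?_
  simp only [zero_smul, add_zero, stdGaussianDensity, real_inner_comm a u,
    smul_apply, innerSL_apply_apply, nsmul_eq_mul]
  ring

lemma hasLineDerivAt_inner_mul_norm_pow (a u : E) (k : ℕ) :
    HasLineDerivAt ℝ (fun u => ⟪a, u⟫ * ‖u‖ ^ (2 * k + 2))
      (‖a‖ ^ 2 * ‖u‖ ^ (2 * k + 2) + (2 * k + 2) * (⟪a, u⟫ ^ 2 * ‖u‖ ^ (2 * k))) u a := by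
  have hinner := ((innerSL ℝ a).hasFDerivAt (x := u)).hasLineDerivAt a
  have hnorm := (((hasStrictFDerivAt_norm_sq u).hasFDerivAt.pow (k + 1))).hasLineDerivAt a
  have hprod := HasDerivAt.mul hinner hnorm
  simp only [← pow_mul] at hprod
  refine (hprod.congr_deriv ?_).congr_of_eventuallyEq (.of_forall fun t => ?_)
  · simp [real_inner_comm a u]
    ring
  · simp [mul_add]

variable [FiniteDimensional ℝ E] [MeasurableSpace E] [BorelSpace E]

lemma integrable_stdGaussianDensity : Integrable (stdGaussianDensity (E := E)) := by
  have h := (GaussianFourier.integrable_cexp_neg_mul_sq_norm_add (V := E)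
    (b := (1 / 2 : ℝ)) (by norm_num) 0 0).norm
  refine (h.const_mul ((2 * Real.pi) ^ (-(finrank ℝ E : ℝ) / 2))).congr (.of_forall fun u => ?_)
  simp only [Complex.norm_exp, stdGaussianDensity, zero_mul, add_zero]
  norm_cast

lemma stdGaussian_eq_withDensity :
    stdGaussian E = volume.withDensity fun u => ENNReal.ofReal (stdGaussianDensity u) := by
  have : IsFiniteMeasure
      (volume.withDensity fun u : E => ENNReal.ofReal (stdGaussianDensity u)) :=
    isFiniteMeasure_withDensity_ofReal integrable_stdGaussianDensity.2
  refine Measure.ext_of_charFun (funext fun t => ?_)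
  have hbase : (2 * Real.pi : ℂ) ≠ 0 := by exact_mod_cast Real.two_pi_pos.ne'
  have hexp : ∀ u : E, (ENNReal.ofReal (stdGaussianDensity u)).toReal •
      Complex.exp (⟪u, t⟫ * Complex.I) = (2 * Real.pi : ℂ) ^ (-(finrank ℝ E : ℂ) / 2) *
        Complex.exp (-(1 / 2) * ‖u‖ ^ 2 + Complex.I * ⟪t, u⟫) := fun u => by
    rw [ENNReal.toReal_ofReal (stdGaussianDensity_nonneg u), Complex.exp_add, stdGaussianDensity,
      real_inner_comm, mul_comm Complex.I, Complex.real_smul, Complex.ofReal_mul,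
      Complex.ofReal_cpow Real.two_pi_pos.le, Complex.ofReal_exp]
    push_cast
    ring
  rw [charFun_stdGaussian, charFun_apply, integral_withDensity_eq_integral_toReal_smul
    continuous_stdGaussianDensity.measurable.ennreal_ofReal (by simp)]
  simp_rw [hexp]
  rw [integral_const_mul, GaussianFourier.integral_cexp_neg_mul_sq_norm_add (by norm_num),
    ← mul_assoc, div_div_eq_mul_div, div_one, mul_comm (Real.pi : ℂ) 2,
    ← Complex.cpow_add _ _ hbase, ← add_div, neg_add_cancel, zero_div, Complex.cpow_zero, one_mul,
    Complex.I_sq]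
  ring_nf

/-- Gaussian integration by parts (Stein's identity). -/
lemma integral_inner_mul_stdGaussian {φ φ' : E → ℝ} {a : E}
    (hφ : ∀ u, HasLineDerivAt ℝ φ (φ' u) u a)
    (hφ_int : Integrable φ (stdGaussian E)) (hφ'_int : Integrable φ' (stdGaussian E))
    (hinner_int : Integrable (fun u => ⟪a, u⟫ * φ u) (stdGaussian E)) :
    ∫ u, ⟪a, u⟫ * φ u ∂(stdGaussian E) = ∫ u, φ' u ∂(stdGaussian E) := by
  have hmeas : Measurable fun u : E => ENNReal.ofReal (stdGaussianDensity u) :=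
    continuous_stdGaussianDensity.measurable.ennreal_ofReal
  have hint : ∀ {ψ : E → ℝ}, Integrable ψ (stdGaussian E) →
      Integrable fun u => ψ u * stdGaussianDensity u := fun {ψ} hψ => by
    rw [stdGaussian_eq_withDensity, integrable_withDensity_iff hmeas (by simp)] at hψ
    simpa only [ENNReal.toReal_ofReal (stdGaussianDensity_nonneg _)] using hψ
  have hintegral : ∀ ψ : E → ℝ,
      ∫ u, ψ u ∂(stdGaussian E) = ∫ u, ψ u * stdGaussianDensity u := fun ψ => by
    rw [stdGaussian_eq_withDensity, integral_withDensity_eq_integral_toReal_smul hmeas (by simp)]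
    simp only [ENNReal.toReal_ofReal (stdGaussianDensity_nonneg _), smul_eq_mul, mul_comm]
  have hparts := integral_bilinear_hasLineDerivAt_right_eq_neg_left_of_integrable
    (B := ContinuousLinearMap.mul ℝ ℝ) (μ := (volume : Measure E)) (hint hφ'_int)
    (by simpa [mul_comm, mul_left_comm, mul_assoc] using (hint hinner_int).neg) (hint hφ_int)
    (fun u _ => hφ u) (fun u _ => hasLineDerivAt_stdGaussianDensity a u)
  simp only [ContinuousLinearMap.mul_apply', mul_neg, integral_neg, neg_inj] at hparts
  rw [hintegral, hintegral, ← hparts]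
  congr with u
  ring

lemma integrable_norm_pow_stdGaussian (k : ℕ) :
    Integrable (fun u : E => ‖u‖ ^ k) (stdGaussian E) := by
  simpa using (IsGaussian.memLp_id (stdGaussian E) k (by simp)).integrable_norm_pow'

lemma integrable_stdGaussian_of_norm_le_pow {G : Type*} [NormedAddCommGroup G] {φ : E → G}
    (hφ : AEStronglyMeasurable φ (stdGaussian E)) (C : ℝ) (k : ℕ)
    (h : ∀ u, ‖φ u‖ ≤ C * ‖u‖ ^ k) : Integrable φ (stdGaussian E) :=
  ((integrable_norm_pow_stdGaussian k).const_mul C).mono' hφ (.of_forall h)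

lemma memLp_two_stdGaussian_of_norm_le_pow {G : Type*} [NormedAddCommGroup G] {φ : E → G}
    (hφ : AEStronglyMeasurable φ (stdGaussian E)) (C : ℝ) (k : ℕ)
    (h : ∀ u, ‖φ u‖ ≤ C * ‖u‖ ^ k) : MemLp φ 2 (stdGaussian E) := by
  refine (memLp_two_iff_integrable_sq_norm hφ).2
    (integrable_stdGaussian_of_norm_le_pow (hφ.norm.pow 2) (C ^ 2) (k * 2) fun u => ?_)
  rw [norm_pow, norm_norm, pow_mul, ← mul_pow]
  gcongr
  exact h u

lemma memLp_two_inner_smul_stdGaussian (a : E) :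
    MemLp (fun u : E => ⟪a, u⟫ • u) 2 (stdGaussian E) := by
  refine memLp_two_stdGaussian_of_norm_le_pow (by fun_prop) ‖a‖ 2 fun u => ?_
  rw [norm_smul, pow_two, ← mul_assoc]
  gcongr
  exact norm_inner_le_norm a u

lemma integral_inner_smul_stdGaussian (a : E) :
    ∫ u, ⟪a, u⟫ • u ∂(stdGaussian E) = a := by
  refine ext_inner_left ℝ fun w => ?_
  have hcov := covarianceBilin_apply (μ := stdGaussian E) IsGaussian.memLp_two_id w a
  rw [covarianceBilin_stdGaussian, innerSL_apply_apply] at hcov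
  simp only [id, integral_id_stdGaussian, sub_zero] at hcov
  rw [← integral_inner ((memLp_two_inner_smul_stdGaussian a).integrable one_le_two) w, hcov]
  simp only [real_inner_smul_right, mul_comm]

lemma integrable_inner_sq_mul_norm_pow_stdGaussian (a : E) (k : ℕ) :
    Integrable (fun u => ⟪a, u⟫ ^ 2 * ‖u‖ ^ k) (stdGaussian E) := by
  refine integrable_stdGaussian_of_norm_le_pow (by fun_prop) (‖a‖ ^ 2) (k + 2) fun u => ?_
  rw [norm_mul, norm_pow, norm_pow, norm_norm, pow_add, mul_comm (‖u‖ ^ k), ← mul_assoc, ← mul_pow]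
  gcongr
  exact norm_inner_le_norm a u

lemma integral_inner_sq_stdGaussian (a : E) :
    ∫ u, ⟪a, u⟫ ^ 2 ∂(stdGaussian E) = ‖a‖ ^ 2 := by
  have hcov := covarianceBilin_apply (μ := stdGaussian E) IsGaussian.memLp_two_id a a
  rw [covarianceBilin_stdGaussian, innerSL_apply_apply, real_inner_self_eq_norm_sq] at hcov
  simpa only [id, integral_id_stdGaussian, sub_zero, ← pow_two] using hcov.symm

lemma integral_inner_sq_mul_norm_pow_stdGaussian (a : E) (k : ℕ) :
    ∫ u, ⟪a, u⟫ ^ 2 * ‖u‖ ^ (2 * k + 2) ∂(stdGaussian E) =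
      ‖a‖ ^ 2 * ∫ u, ‖u‖ ^ (2 * k + 2) ∂(stdGaussian E) +
        (2 * k + 2) * ∫ u, ⟪a, u⟫ ^ 2 * ‖u‖ ^ (2 * k) ∂(stdGaussian E) := by
  have hnorm := (integrable_norm_pow_stdGaussian (E := E) (2 * k + 2)).const_mul (‖a‖ ^ 2)
  have hinner := (integrable_inner_sq_mul_norm_pow_stdGaussian a (2 * k)).const_mul (2 * k + 2 : ℝ)
  rw [← integral_const_mul, ← integral_const_mul, ← integral_add hnorm hinner,
    ← integral_inner_mul_stdGaussian (fun u => hasLineDerivAt_inner_mul_norm_pow a u k) ?_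
      (hnorm.add hinner) ?_]
  · simp only [pow_two, mul_assoc]
  · refine integrable_stdGaussian_of_norm_le_pow (by fun_prop) ‖a‖ (2 * k + 3) fun u => ?_
    rw [norm_mul, norm_pow, norm_norm, pow_succ' ‖u‖ (2 * k + 2), ← mul_assoc]
    gcongr
    exact norm_inner_le_norm a u
  · simpa only [pow_two, mul_assoc] using
      integrable_inner_sq_mul_norm_pow_stdGaussian a (2 * k + 2)

lemma integral_norm_pow_add_two_stdGaussian (k : ℕ) :
    ∫ u, ‖u‖ ^ (k + 2) ∂(stdGaussian E) =
      ∑ i, ∫ u, ⟪stdOrthonormalBasis ℝ E i, u⟫ ^ 2 * ‖u‖ ^ k ∂(stdGaussian E) := by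
  rw [← integral_finsetSum _ fun i _ => integrable_inner_sq_mul_norm_pow_stdGaussian _ k]
  simp only [← Finset.sum_mul, OrthonormalBasis.sum_sq_inner_right, ← pow_add, add_comm]

lemma integral_norm_sq_stdGaussian : ∫ u, ‖u‖ ^ 2 ∂(stdGaussian E) = finrank ℝ E := by
  have h := integral_norm_pow_add_two_stdGaussian (E := E) 0
  simpa [integral_inner_sq_stdGaussian] using h

lemma integral_norm_pow_stdGaussian_succ (k : ℕ) :
    ∫ u, ‖u‖ ^ (2 * k + 2 + 2) ∂(stdGaussian E) =
      (finrank ℝ E + (2 * k + 2)) * ∫ u, ‖u‖ ^ (2 * k + 2) ∂(stdGaussian E) := by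
  rw [integral_norm_pow_add_two_stdGaussian, add_mul, integral_norm_pow_add_two_stdGaussian (2 * k),
    Finset.mul_sum]
  simp only [integral_inner_sq_mul_norm_pow_stdGaussian, OrthonormalBasis.norm_eq_one,
    Finset.sum_add_distrib]
  simp [Finset.mul_sum, integral_norm_pow_add_two_stdGaussian (2 * k)]

lemma integral_norm_pow_four_stdGaussian :
    ∫ u, ‖u‖ ^ 4 ∂(stdGaussian E) = finrank ℝ E * (finrank ℝ E + 2) := by
  have h := integral_norm_pow_stdGaussian_succ (E := E) 0
  norm_num [integral_norm_sq_stdGaussian] at h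
  rw [h, mul_comm]

lemma integral_norm_pow_six_stdGaussian :
    ∫ u, ‖u‖ ^ 6 ∂(stdGaussian E) =
      finrank ℝ E * (finrank ℝ E + 2) * (finrank ℝ E + 4) := by
  have h := integral_norm_pow_stdGaussian_succ (E := E) 1
  norm_num [integral_norm_pow_four_stdGaussian] at h
  rw [h, mul_comm]

lemma integral_norm_inner_smul_sq_stdGaussian (a : E) :
    ∫ u, ‖⟪a, u⟫ • u‖ ^ 2 ∂(stdGaussian E) = (finrank ℝ E + 2) * ‖a‖ ^ 2 := by
  simp only [norm_smul, mul_pow, Real.norm_eq_abs, sq_abs]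
  have h := integral_inner_sq_mul_norm_pow_stdGaussian a 0
  norm_num [integral_norm_sq_stdGaussian, integral_inner_sq_stdGaussian] at h
  rw [h]
  ring

end GaussianMoments

section Smoothness

open scoped RealInnerProductSpace

lemma norm_sq_le_two_mul_add {E : Type*} [SeminormedAddCommGroup E] (a b : E) :
    ‖a‖ ^ 2 ≤ 2 * ‖b‖ ^ 2 + 2 * ‖a - b‖ ^ 2 := by
  have h : ‖a‖ ≤ ‖b‖ + ‖a - b‖ := by simpa using norm_add_le b (a - b)
  calc _ ≤ (‖b‖ + ‖a - b‖) ^ 2 := by gcongr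
    _ ≤ 2 * (‖b‖ ^ 2 + ‖a - b‖ ^ 2) := add_sq_le
    _ = _ := mul_add _ _ _

variable {E : Type*} [NormedAddCommGroup E] [InnerProductSpace ℝ E] [CompleteSpace E]

lemma integral_norm_add_sub_mean_sq {Z : Type*} [MeasurableSpace Z] {ν : Measure Z}
    [IsProbabilityMeasure ν] {X : Z → E} (hX : MemLp X 2 ν) (a : E) :
    ∫ z, ‖a + (X z - ∫ w, X w ∂ν)‖ ^ 2 ∂ν =
      ‖a‖ ^ 2 + (∫ z, ‖X z‖ ^ 2 ∂ν - ‖∫ z, X z ∂ν‖ ^ 2) := by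
  set m := ∫ z, X z ∂ν
  have hX_int : Integrable X ν := hX.integrable one_le_two
  have hinner : Integrable (fun z => 2 * ⟪a - m, X z⟫) ν := (hX_int.const_inner _).const_mul 2
  have hsq : Integrable (fun z => ‖X z‖ ^ 2 + 2 * ⟪a - m, X z⟫) ν :=
    hX.integrable_norm_pow'.add hinner
  have hexpand (z : Z) :
      ‖a + (X z - m)‖ ^ 2 = ‖X z‖ ^ 2 + 2 * ⟪a - m, X z⟫ + ‖a - m‖ ^ 2 := by
    rw [show a + (X z - m) = X z + (a - m) by abel, norm_add_sq_real, real_inner_comm]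
  simp only [hexpand]
  rw [integral_add hsq (integrable_const _), integral_add hX.integrable_norm_pow' hinner,
    integral_const_mul, integral_inner hX_int, integral_const, probReal_univ, one_smul,
    inner_sub_left, real_inner_self_eq_norm_sq, norm_sub_sq_real]
  ring

lemma integral_norm_sub_mean_sq {Z : Type*} [MeasurableSpace Z] {ν : Measure Z}
    [IsProbabilityMeasure ν] {X : Z → E} (hX : MemLp X 2 ν) :
    ∫ z, ‖X z - ∫ w, X w ∂ν‖ ^ 2 ∂ν = ∫ z, ‖X z‖ ^ 2 ∂ν - ‖∫ z, X z ∂ν‖ ^ 2 := by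
  simpa using integral_norm_add_sub_mean_sq hX 0

lemma norm_integral_sq_le {Z : Type*} [MeasurableSpace Z] {ν : Measure Z}
    [IsProbabilityMeasure ν] {X : Z → E} (hX : MemLp X 2 ν) :
    ‖∫ z, X z ∂ν‖ ^ 2 ≤ ∫ z, ‖X z‖ ^ 2 ∂ν := by
  rw [← sub_nonneg, ← integral_norm_sub_mean_sq hX]
  positivity

lemma hasDerivAt_comp_add_smul {g : E → ℝ} (hg : Differentiable ℝ g) (x v : E) (t : ℝ) :
    HasDerivAt (fun s : ℝ => g (x + s • v)) ⟪gradient g (x + t • v), v⟫ t := by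
  have hline : HasDerivAt (fun s : ℝ => x + s • v) v t := by
    simpa using ((hasDerivAt_id t).smul_const v).const_add x
  have hcomp := (hg (x + t • v)).hasGradientAt.hasFDerivAt.comp_hasDerivAt t hline
  rwa [InnerProductSpace.toDual_apply_apply] at hcomp

lemma abs_sub_sub_inner_gradient_le {L : ℝ} {g : E → ℝ} (hg : Differentiable ℝ g)
    (hL : ∀ x y, ‖gradient g y - gradient g x‖ ≤ L * ‖y - x‖) (x v : E) :
    |g (x + v) - g x - ⟪gradient g x, v⟫| ≤ L / 2 * ‖v‖ ^ 2 := by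
  have hremainder (t : ℝ) : HasDerivAt (fun s : ℝ => g (x + s • v) - g x - s * ⟪gradient g x, v⟫)
      ⟪gradient g (x + t • v) - gradient g x, v⟫ t := by
    refine (((hasDerivAt_comp_add_smul hg x v t).sub_const (g x)).sub
      ((hasDerivAt_id t).mul_const ⟪gradient g x, v⟫)).congr_deriv ?_
    rw [one_mul, inner_sub_left]
  have hquadratic (t : ℝ) :
      HasDerivAt (fun s : ℝ => L / 2 * ‖v‖ ^ 2 * s ^ 2) (L * ‖v‖ ^ 2 * t) t := by
    refine (((hasDerivAt_id t).pow 2).const_mul (L / 2 * ‖v‖ ^ 2)).congr_deriv ?_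
    simp only [id, Nat.cast_ofNat, Nat.add_one_sub_one, pow_one]
    ring
  have hderiv_le (t : ℝ) (ht : t ∈ Set.Ico (0 : ℝ) 1) :
      ‖⟪gradient g (x + t • v) - gradient g x, v⟫‖ ≤ L * ‖v‖ ^ 2 * t := by
    have hlip := hL x (x + t • v)
    rw [add_sub_cancel_left, norm_smul, Real.norm_of_nonneg ht.1] at hlip
    calc _ ≤ ‖gradient g (x + t • v) - gradient g x‖ * ‖v‖ := norm_inner_le_norm _ _
      _ ≤ L * (t * ‖v‖) * ‖v‖ := by gcongr
      _ = _ := by ring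
  simpa using image_norm_le_of_norm_deriv_right_le_deriv_boundary
    (fun t _ => (hremainder t).continuousAt.continuousWithinAt)
    (fun t _ => (hremainder t).hasDerivWithinAt) (by simp) hquadratic hderiv_le
    (Set.right_mem_Icc.2 zero_le_one)

lemma hasGradientAt_of_abs_sub_le_sq {g : E → ℝ} {x v : E} {C : ℝ}
    (h : ∀ y, |g y - g x - ⟪v, y - x⟫| ≤ C * ‖y - x‖ ^ 2) : HasGradientAt g v x := by
  rw [hasGradientAt_iff_isLittleO]
  refine (Asymptotics.IsBigO.of_bound C (.of_forall fun y => ?_) :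
    _ =O[nhds x] fun y => ‖y - x‖ ^ 2).trans_isLittleO ?_
  · rw [norm_pow, norm_norm]
    exact h y
  · exact (Asymptotics.isLittleO_norm_pow_id one_lt_two).comp_tendsto
      (Continuous.tendsto' (by fun_prop : Continuous fun y => y - x) x 0 (sub_self x))

end Smoothness

section Objective

open scoped RealInnerProductSpace

variable {n : ℕ}

local notation "𝔼" n => EuclideanSpace ℝ (Fin n)

lemma IsC11.abs_sub_inner_le {L : ℝ} {g : (𝔼 n) → ℝ} (hg : IsC11 L g) (x v : 𝔼 n) :
    |g (x + v) - g x - ⟪gradient g x, v⟫| ≤ L / 2 * ‖v‖ ^ 2 :=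
  abs_sub_sub_inner_gradient_le hg.1 hg.2 x v

lemma IsC11.le_add {L : ℝ} {g : (𝔼 n) → ℝ} (hg : IsC11 L g) (x v : 𝔼 n) :
    g (x + v) ≤ g x + ⟪gradient g x, v⟫ + L / 2 * ‖v‖ ^ 2 := by
  have := (abs_le.1 (hg.abs_sub_inner_le x v)).2
  linarith

lemma IsC11.continuous_gradient {L : ℝ} {g : (𝔼 n) → ℝ} (hg : IsC11 L g) :
    Continuous (gradient g) :=
  (LipschitzWith.of_dist_le' fun x y => by
    simpa only [dist_eq_norm] using hg.2 y x).continuous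

variable {Ξ : Type*} [MeasurableSpace Ξ] {F : (𝔼 n) → Ξ → ℝ} {P : Measure Ξ} {L : ℝ}

lemma integrable_inner_gradient [IsFiniteMeasure P] (hF_int : ∀ x, Integrable (F x) P)
    (hF_smooth : ∀ᵐ ξ ∂P, IsC11 L (fun x => F x ξ)) (x v : 𝔼 n) :
    Integrable (fun ξ => ⟪v, gradient (fun y => F y ξ) x⟫) P := by
  have hmeas : AEStronglyMeasurable (fun ξ => ⟪v, gradient (fun y => F y ξ) x⟫) P := by
    refine aestronglyMeasurable_of_tendsto_ae (nhdsWithin (0 : ℝ) {0}ᶜ)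
      (f := fun (t : ℝ) ξ => t⁻¹ • (F (x + t • v) ξ - F x ξ))
      (fun t => (((hF_int _).sub (hF_int _)).smul t⁻¹).aestronglyMeasurable) ?_
    filter_upwards [hF_smooth] with ξ hξ
    simpa [real_inner_comm] using (hasDerivAt_comp_add_smul hξ.1 x v 0).tendsto_slope_zero
  refine (((hF_int (x + v)).sub (hF_int x)).norm.add
    (integrable_const (L / 2 * ‖v‖ ^ 2))).mono' hmeas ?_
  filter_upwards [hF_smooth] with ξ hξ
  have htaylor := hξ.abs_sub_inner_le x v
  rw [abs_sub_comm, real_inner_comm] at htaylor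
  have := (abs_sub_abs_le_abs_sub _ _).trans htaylor
  simp only [Pi.add_apply, Pi.sub_apply, Real.norm_eq_abs]
  linarith

lemma integrable_gradient [IsFiniteMeasure P] (hF_int : ∀ x, Integrable (F x) P)
    (hF_smooth : ∀ᵐ ξ ∂P, IsC11 L (fun x => F x ξ)) (x : 𝔼 n) :
    Integrable (fun ξ => gradient (fun y => F y ξ) x) P := by
  have hsum : (fun ξ => gradient (fun y => F y ξ) x) = fun ξ =>
      ∑ i, ⟪EuclideanSpace.basisFun (Fin n) ℝ i, gradient (fun y => F y ξ) x⟫ •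
        EuclideanSpace.basisFun (Fin n) ℝ i :=
    funext fun ξ => (OrthonormalBasis.sum_repr' _ _).symm
  rw [hsum]
  exact integrable_finsetSum _ fun i _ =>
    (integrable_inner_gradient hF_int hF_smooth x _).smul_const _

lemma hasGradientAt_objective [IsProbabilityMeasure P] (hF_int : ∀ x, Integrable (F x) P)
    (hF_smooth : ∀ᵐ ξ ∂P, IsC11 L (fun x => F x ξ)) (x : 𝔼 n) :
    HasGradientAt (objective F P) (∫ ξ, gradient (fun y => F y ξ) x ∂P) x := by
  have hgrad := integrable_gradient hF_int hF_smooth x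
  refine hasGradientAt_of_abs_sub_le_sq (C := L / 2) fun y => ?_
  have hremainder : objective F P y - objective F P x
      - ⟪∫ ξ, gradient (fun y => F y ξ) x ∂P, y - x⟫ =
      ∫ ξ, (F y ξ - F x ξ - ⟪gradient (fun y => F y ξ) x, y - x⟫) ∂P := by
    simp only [real_inner_comm (y - x)]
    have hdiff : Integrable (fun ξ => F y ξ - F x ξ) P := (hF_int y).sub (hF_int x)
    rw [integral_sub hdiff (hgrad.const_inner _), integral_sub (hF_int y) (hF_int x),
      integral_inner hgrad, objective, objective]
  rw [hremainder, ← Real.norm_eq_abs]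
  refine (norm_integral_le_of_norm_le_const (C := L / 2 * ‖y - x‖ ^ 2) ?_).trans (by simp)
  filter_upwards [hF_smooth] with ξ hξ
  simpa using hξ.abs_sub_inner_le x (y - x)

lemma isC11_objective [IsProbabilityMeasure P] (hF_int : ∀ x, Integrable (F x) P)
    (hF_smooth : ∀ᵐ ξ ∂P, IsC11 L (fun x => F x ξ)) : IsC11 L (objective F P) := by
  refine ⟨fun x => (hasGradientAt_objective hF_int hF_smooth x).differentiableAt, fun x y => ?_⟩
  rw [(hasGradientAt_objective hF_int hF_smooth x).gradient,
    (hasGradientAt_objective hF_int hF_smooth y).gradient,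
    ← integral_sub (integrable_gradient hF_int hF_smooth y)
      (integrable_gradient hF_int hF_smooth x)]
  refine (norm_integral_le_of_norm_le_const (C := L * ‖y - x‖) ?_).trans (by simp)
  filter_upwards [hF_smooth] with ξ hξ using hξ.2 x y

end Objective

section TwoPointEstimate

open Module
open scoped RealInnerProductSpace

variable {n : ℕ}

local notation "𝔼" n => EuclideanSpace ℝ (Fin n)

/-- The forward difference quotient of `g` at `x` in the direction `u`, times `u`. -/
noncomputable def diffQuot (g : (𝔼 n) → ℝ) (μ : ℝ) (x u : 𝔼 n) : 𝔼 n :=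
  ((g (x + μ • u) - g x) / μ) • u

/-- The gradient at `x` of the Gaussian smoothing `y ↦ E[g(y + μ u)]` of `g`, written as the mean of
`diffQuot` over a standard Gaussian direction. -/
noncomputable def smoothedGradient (g : (𝔼 n) → ℝ) (μ : ℝ) (x : 𝔼 n) : 𝔼 n :=
  ∫ u, diffQuot g μ x u ∂(stdGaussian (𝔼 n))

/-- A bound on the mean squared error that is made when `g` is replaced by its linear part in
`diffQuot g μ`, for `g` of class `C_L^{1,1}`. -/
noncomputable def smoothingError (n : ℕ) (L μ : ℝ) : ℝ := μ ^ 2 * L ^ 2 * (n + 4) ^ 3 / 4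

lemma smoothingError_nonneg (n : ℕ) (L μ : ℝ) : 0 ≤ smoothingError n L μ := by
  unfold smoothingError; positivity

variable {L μ : ℝ} {g f : (𝔼 n) → ℝ}

lemma IsC11.continuous_diffQuot (hg : IsC11 L g) (x : 𝔼 n) : Continuous (diffQuot g μ x) := by
  have := hg.1.continuous
  unfold diffQuot
  fun_prop

lemma IsC11.measurable_smoothedGradient (hg : IsC11 L g) : Measurable (smoothedGradient g μ) := by
  have := hg.1.continuous
  have hquot : Continuous fun p : (𝔼 n) × (𝔼 n) => diffQuot g μ p.1 p.2 := by
    unfold diffQuot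
    fun_prop
  exact hquot.stronglyMeasurable.integral_prod_right'.measurable

lemma IsC11.norm_diffQuot_sub_le (hμ : 0 < μ) (hg : IsC11 L g) (x u : 𝔼 n) :
    ‖diffQuot g μ x u - ⟪gradient g x, u⟫ • u‖ ≤ μ * L / 2 * ‖u‖ ^ 3 := by
  have htaylor := hg.abs_sub_inner_le x (μ • u)
  rw [real_inner_smul_right, norm_smul, Real.norm_of_nonneg hμ.le] at htaylor
  have hquot : (g (x + μ • u) - g x) / μ - ⟪gradient g x, u⟫ =
      (g (x + μ • u) - g x - μ * ⟪gradient g x, u⟫) / μ := by field_simp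
  rw [diffQuot, ← sub_smul, norm_smul, hquot, norm_div, Real.norm_of_nonneg hμ.le,
    Real.norm_eq_abs]
  calc _ ≤ (L / 2 * (μ * ‖u‖) ^ 2) / μ * ‖u‖ := by gcongr
    _ = _ := by field_simp

lemma IsC11.memLp_diffQuot_sub (hμ : 0 < μ) (hg : IsC11 L g) (x : 𝔼 n) :
    MemLp (fun u => diffQuot g μ x u - ⟪gradient g x, u⟫ • u) 2 (stdGaussian (𝔼 n)) :=
  memLp_two_stdGaussian_of_norm_le_pow
    ((hg.continuous_diffQuot x).sub (by fun_prop)).aestronglyMeasurable _ 3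
    fun u => hg.norm_diffQuot_sub_le hμ x u

lemma IsC11.memLp_diffQuot (hμ : 0 < μ) (hg : IsC11 L g) (x : 𝔼 n) :
    MemLp (diffQuot g μ x) 2 (stdGaussian (𝔼 n)) :=
  ((hg.memLp_diffQuot_sub hμ x).add (memLp_two_inner_smul_stdGaussian (gradient g x))).congr_norm
    (hg.continuous_diffQuot x).aestronglyMeasurable
    (.of_forall fun u => by rw [Pi.add_apply, sub_add_cancel])

lemma IsC11.integral_norm_diffQuot_sub_sq_le (hμ : 0 < μ) (hg : IsC11 L g) (x : 𝔼 n) :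
    ∫ u, ‖diffQuot g μ x u - ⟪gradient g x, u⟫ • u‖ ^ 2 ∂(stdGaussian (𝔼 n)) ≤
      smoothingError n L μ :=
  calc _ ≤ ∫ u, μ ^ 2 * L ^ 2 / 4 * ‖u‖ ^ 6 ∂(stdGaussian (𝔼 n)) := by
        refine integral_mono (hg.memLp_diffQuot_sub hμ x).integrable_norm_pow'
          ((integrable_norm_pow_stdGaussian 6).const_mul _) fun u => ?_
        calc _ ≤ (μ * L / 2 * ‖u‖ ^ 3) ^ 2 := by gcongr; exact hg.norm_diffQuot_sub_le hμ x u
          _ = _ := by ring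
    _ = μ ^ 2 * L ^ 2 / 4 * (n * (n + 2) * (n + 4)) := by
        rw [integral_const_mul, integral_norm_pow_six_stdGaussian, finrank_euclideanSpace_fin]
    _ ≤ μ ^ 2 * L ^ 2 / 4 * ((n + 4) * (n + 4) * (n + 4)) := by gcongr <;> linarith
    _ = smoothingError n L μ := by rw [smoothingError]; ring

lemma IsC11.norm_smoothedGradient_sub_sq_le (hμ : 0 < μ) (hg : IsC11 L g) (x : 𝔼 n) :
    ‖smoothedGradient g μ x - gradient g x‖ ^ 2 ≤ smoothingError n L μ := by
  conv_lhs => rw [← integral_inner_smul_stdGaussian (gradient g x), smoothedGradient,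
    ← integral_sub ((hg.memLp_diffQuot hμ x).integrable one_le_two)
      ((memLp_two_inner_smul_stdGaussian _).integrable one_le_two)]
  exact (norm_integral_sq_le (hg.memLp_diffQuot_sub hμ x)).trans
    (hg.integral_norm_diffQuot_sub_sq_le hμ x)

lemma IsC11.integral_norm_diffQuot_sq_le (hμ : 0 < μ) (hg : IsC11 L g) (x : 𝔼 n) :
    ∫ u, ‖diffQuot g μ x u‖ ^ 2 ∂(stdGaussian (𝔼 n)) ≤
      2 * (n + 4) * ‖gradient g x‖ ^ 2 + 2 * smoothingError n L μ := by
  have hlin := (memLp_two_inner_smul_stdGaussian (gradient g x)).integrable_norm_pow'.const_mul 2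
  have herr := (hg.memLp_diffQuot_sub hμ x).integrable_norm_pow'.const_mul 2
  calc _ ≤ ∫ u, (2 * ‖⟪gradient g x, u⟫ • u‖ ^ 2 +
          2 * ‖diffQuot g μ x u - ⟪gradient g x, u⟫ • u‖ ^ 2) ∂(stdGaussian (𝔼 n)) :=
        integral_mono (hg.memLp_diffQuot hμ x).integrable_norm_pow' (hlin.add herr)
          fun u => norm_sq_le_two_mul_add _ _
    _ = 2 * ((n + 2) * ‖gradient g x‖ ^ 2) +
          2 * ∫ u, ‖diffQuot g μ x u - ⟪gradient g x, u⟫ • u‖ ^ 2 ∂(stdGaussian (𝔼 n)) := by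
        rw [integral_add hlin herr, integral_const_mul, integral_const_mul,
          integral_norm_inner_smul_sq_stdGaussian, finrank_euclideanSpace_fin]
    _ ≤ 2 * ((n + 4) * ‖gradient g x‖ ^ 2) + 2 * smoothingError n L μ := by
        gcongr
        · norm_num
        · exact hg.integral_norm_diffQuot_sub_sq_le hμ x
    _ = _ := by ring

end TwoPointEstimate

section Estimator

open scoped RealInnerProductSpace

/-- Under the law `ν` of the noise, `g` is at every point an estimate of `m` with second moment at
most `V`. -/
structure IsEstimator {E Z : Type*} [NormedAddCommGroup E] [NormedSpace ℝ E] [MeasurableSpace Z]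
    (g : E → Z → E) (m : E → E) (V : E → ℝ) (ν : Measure Z) : Prop where
  memLp : ∀ x, MemLp (g x) 2 ν
  integral_eq : ∀ x, ∫ z, g x z ∂ν = m x
  integral_norm_sq_le : ∀ x, ∫ z, ‖g x z‖ ^ 2 ∂ν ≤ V x

variable {n : ℕ}

local notation "𝔼" n => EuclideanSpace ℝ (Fin n)

/-- The estimator `G_μ` of the method, as a function of the sample `(ξ, u)`. -/
noncomputable def twoPointEstimate {Ξ : Type*} (F : (𝔼 n) → Ξ → ℝ) (μ : ℝ) (x : 𝔼 n)
    (z : Ξ × (𝔼 n)) : 𝔼 n :=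
  diffQuot (fun y => F y z.1) μ x z.2

/-- The part of the bound on the second moment of `twoPointEstimate` that remains where `∇f`
vanishes. -/
noncomputable def noiseLevel (n : ℕ) (L σ μ : ℝ) : ℝ :=
  2 * (n + 4) * σ ^ 2 + 2 * smoothingError n L μ

lemma noiseLevel_nonneg (n : ℕ) (L σ μ : ℝ) : 0 ≤ noiseLevel n L σ μ :=
  add_nonneg (by positivity) (mul_nonneg zero_le_two (smoothingError_nonneg n L μ))

variable {Ξ : Type*} [MeasurableSpace Ξ] {F : (𝔼 n) → Ξ → ℝ} {f : (𝔼 n) → ℝ} {L σ μ : ℝ}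
  {Q : Measure Ξ}

lemma measurable_twoPointEstimate (hF : Measurable (Function.uncurry F)) (μ : ℝ) :
    Measurable (Function.uncurry (twoPointEstimate F μ)) := by
  have hshift : Measurable fun p : (𝔼 n) × Ξ × (𝔼 n) => F (p.1 + μ • p.2.2) p.2.1 :=
    hF.comp (f := fun p : (𝔼 n) × Ξ × (𝔼 n) => (p.1 + μ • p.2.2, p.2.1)) (by fun_prop)
  have hvalue : Measurable fun p : (𝔼 n) × Ξ × (𝔼 n) => F p.1 p.2.1 :=
    hF.comp (f := fun p : (𝔼 n) × Ξ × (𝔼 n) => (p.1, p.2.1)) (by fun_prop)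
  exact ((hshift.sub hvalue).div_const μ).smul measurable_snd.snd

variable [IsProbabilityMeasure Q]

lemma OracleLaw.memLp_gradient (hQ : OracleLaw F f L σ Q) (x : 𝔼 n) :
    MemLp (fun ξ => gradient (fun y => F y ξ) x) 2 Q := by
  have hmeas := (hQ.grad_integrable x).aestronglyMeasurable
  have hcentered := (memLp_two_iff_integrable_sq_norm
    (hmeas.sub aestronglyMeasurable_const)).2 (hQ.var_integrable x)
  exact (hcentered.add (memLp_const (gradient f x))).congr_norm hmeas
    (.of_forall fun ξ => by simp only [Pi.add_apply, Pi.sub_apply, sub_add_cancel])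

lemma OracleLaw.integral_norm_gradient_sq_le (hQ : OracleLaw F f L σ Q) (x : 𝔼 n) :
    ∫ ξ, ‖gradient (fun y => F y ξ) x‖ ^ 2 ∂Q ≤ ‖gradient f x‖ ^ 2 + σ ^ 2 := by
  have hvar := integral_norm_sub_mean_sq (hQ.memLp_gradient x)
  rw [hQ.grad_mean x] at hvar
  linarith [hQ.var_le x]

lemma OracleLaw.memLp_twoPointEstimate (hF : Measurable (Function.uncurry F)) (hμ : 0 < μ)
    (hQ : OracleLaw F f L σ Q) (x : 𝔼 n) :
    MemLp (twoPointEstimate F μ x) 2 (Q.prod (stdGaussian (𝔼 n))) := by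
  have hmeas : AEStronglyMeasurable (twoPointEstimate F μ x) (Q.prod (stdGaussian (𝔼 n))) :=
    ((measurable_twoPointEstimate hF μ).of_uncurry_left (x := x)).aestronglyMeasurable
  have hmeas_sq : AEStronglyMeasurable (fun z => ‖twoPointEstimate F μ x z‖ ^ 2)
      (Q.prod (stdGaussian (𝔼 n))) := hmeas.norm.pow 2
  rw [memLp_two_iff_integrable_sq_norm hmeas, integrable_prod_iff hmeas_sq]
  constructor
  · filter_upwards [hQ.smooth] with ξ hξ using (hξ.memLp_diffQuot hμ x).integrable_norm_pow'
  · refine (((hQ.memLp_gradient x).integrable_norm_pow'.const_mul (2 * (n + 4))).add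
      (integrable_const (2 * smoothingError n L μ))).mono'
      hmeas_sq.norm.integral_prod_right' ?_
    filter_upwards [hQ.smooth] with ξ hξ
    simp only [norm_pow, norm_norm]
    rw [Real.norm_of_nonneg (by positivity)]
    exact hξ.integral_norm_diffQuot_sq_le hμ x

lemma OracleLaw.integral_twoPointEstimate (hF : Measurable (Function.uncurry F)) (hμ : 0 < μ)
    (hQ : OracleLaw F f L σ Q) (x : 𝔼 n) :
    ∫ z, twoPointEstimate F μ x z ∂(Q.prod (stdGaussian (𝔼 n))) = smoothedGradient f μ x := by
  rw [integral_prod_symm _ ((hQ.memLp_twoPointEstimate hF hμ x).integrable one_le_two),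
    smoothedGradient]
  congr with u : 1
  simp only [twoPointEstimate, diffQuot]
  rw [integral_smul_const, integral_div, integral_sub (hQ.value_integrable _)
    (hQ.value_integrable _), hQ.value_mean, hQ.value_mean]

lemma OracleLaw.integral_norm_twoPointEstimate_sq_le (hF : Measurable (Function.uncurry F))
    (hμ : 0 < μ) (hQ : OracleLaw F f L σ Q) (x : 𝔼 n) :
    ∫ z, ‖twoPointEstimate F μ x z‖ ^ 2 ∂(Q.prod (stdGaussian (𝔼 n))) ≤
      2 * (n + 4) * ‖gradient f x‖ ^ 2 + noiseLevel n L σ μ := by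
  have hint := (hQ.memLp_twoPointEstimate hF hμ x).integrable_norm_pow'
  have hgrad := (hQ.memLp_gradient x).integrable_norm_pow'.const_mul (2 * ((n : ℝ) + 4))
  have hconst := integrable_const (μ := Q) (2 * smoothingError n L μ)
  calc _ ≤ ∫ ξ, (2 * ((n : ℝ) + 4) * ‖gradient (fun y => F y ξ) x‖ ^ 2 +
          2 * smoothingError n L μ) ∂Q := by
        rw [integral_prod _ hint]
        refine integral_mono_ae hint.integral_prod_left (hgrad.add hconst) ?_
        filter_upwards [hQ.smooth] with ξ hξ using hξ.integral_norm_diffQuot_sq_le hμ x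
    _ ≤ 2 * (n + 4) * (‖gradient f x‖ ^ 2 + σ ^ 2) + 2 * smoothingError n L μ := by
        rw [integral_add hgrad hconst, integral_const_mul, integral_const, probReal_univ, one_smul]
        gcongr
        exact hQ.integral_norm_gradient_sq_le x
    _ = _ := by rw [noiseLevel]; ring

lemma OracleLaw.isEstimator_twoPointEstimate (hF : Measurable (Function.uncurry F)) (hμ : 0 < μ)
    (hQ : OracleLaw F f L σ Q) :
    IsEstimator (twoPointEstimate F μ) (smoothedGradient f μ)
      (fun x => 2 * (n + 4) * ‖gradient f x‖ ^ 2 + noiseLevel n L σ μ)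
      (Q.prod (stdGaussian (𝔼 n))) where
  memLp := hQ.memLp_twoPointEstimate hF hμ
  integral_eq := hQ.integral_twoPointEstimate hF hμ
  integral_norm_sq_le := hQ.integral_norm_twoPointEstimate_sq_le hF hμ

end Estimator

section ConditionalLaw

open scoped ENNReal

variable {Ω 𝓗 Z E : Type*} [MeasurableSpace Ω] [m𝓗 : MeasurableSpace 𝓗] [MeasurableSpace Z]
  [StandardBorelSpace Z] [Nonempty Z] [MeasurableSpace E] [StandardBorelSpace E] [Nonempty E]
  {Pr : Measure Ω} [IsFiniteMeasure Pr] {H : Ω → 𝓗} {ζ : Ω → Z}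

lemma condDistrib_prodMk_ae_eq_of_indepFun {u : Ω → E} (hH : Measurable H) (hζ : Measurable ζ)
    (hu : Measurable u) (hindep : IndepFun u (fun ω => (H ω, ζ ω)) Pr) :
    condDistrib (fun ω => (ζ ω, u ω)) H Pr =ᵐ[Pr.map H]
      (condDistrib ζ H Pr).prod (Kernel.const 𝓗 (Pr.map u)) := by
  refine condDistrib_ae_eq_of_measure_eq_compProd H (hζ.prodMk hu).aemeasurable ?_
  have hlaw : Pr.map (fun ω => ((H ω, ζ ω), u ω)) =
      (Pr.map H ⊗ₘ condDistrib ζ H Pr).prod (Pr.map u) := by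
    rw [compProd_map_condDistrib hζ.aemeasurable]
    exact (indepFun_iff_map_prod_eq_prod_map_map (hH.prodMk hζ).aemeasurable hu.aemeasurable).1
      hindep.symm
  refine Measure.ext_of_lintegral _ fun φ hφ => ?_
  have hφ' : Measurable fun p : (𝓗 × Z) × E => φ (p.1.1, p.1.2, p.2) :=
    hφ.comp (f := fun p : (𝓗 × Z) × E => (p.1.1, p.1.2, p.2)) (by fun_prop)
  calc ∫⁻ p, φ p ∂(Pr.map fun ω => (H ω, ζ ω, u ω))
      = ∫⁻ p, φ (p.1.1, p.1.2, p.2) ∂(Pr.map fun ω => ((H ω, ζ ω), u ω)) := by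
        rw [lintegral_map hφ (by fun_prop), lintegral_map hφ' (by fun_prop)]
    _ = ∫⁻ h, ∫⁻ z, ∫⁻ v, φ (h, z, v) ∂(Pr.map u) ∂(condDistrib ζ H Pr h) ∂(Pr.map H) := by
        rw [hlaw, lintegral_prod _ hφ'.aemeasurable,
          Measure.lintegral_compProd hφ'.lintegral_prod_right']
    _ = ∫⁻ p, φ p ∂(Pr.map H ⊗ₘ (condDistrib ζ H Pr).prod (Kernel.const 𝓗 (Pr.map u))) := by
        rw [Measure.lintegral_compProd hφ]
        congr with h
        rw [Kernel.prod_apply, Kernel.const_apply, lintegral_prod]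
        exact (hφ.comp measurable_prodMk_left).aemeasurable

lemma setLIntegral_comp_le_of_condDistrib {W : Type*} [MeasurableSpace W] [StandardBorelSpace W]
    [Nonempty W] {X : Ω → W} {B : Set Ω} {ψ : W → Z → ℝ≥0∞} {χ : W → ℝ≥0∞} (hH : Measurable H)
    (hζ : Measurable ζ) (hX : Measurable[m𝓗.comap H] X) (hB : MeasurableSet[m𝓗.comap H] B)
    (hψ : Measurable (Function.uncurry ψ))
    (hle : ∀ᵐ h ∂(Pr.map H), ∀ x, ∫⁻ z, ψ x z ∂(condDistrib ζ H Pr h) ≤ χ x) :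
    ∫⁻ ω in B, ψ (X ω) (ζ ω) ∂Pr ≤ ∫⁻ ω in B, χ (X ω) ∂Pr := by
  obtain ⟨Y, hY, rfl⟩ := hX.exists_eq_measurable_comp
  obtain ⟨C, hC, rfl⟩ := hB
  have hψY : Measurable fun p : 𝓗 × Z => ψ (Y p.1) p.2 :=
    hψ.comp (f := fun p : 𝓗 × Z => (Y p.1, p.2)) (by fun_prop)
  calc ∫⁻ ω in H ⁻¹' C, ψ (Y (H ω)) (ζ ω) ∂Pr
      = ∫⁻ p in C ×ˢ Set.univ, ψ (Y p.1) p.2 ∂(Pr.map fun ω => (H ω, ζ ω)) := by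
        rw [setLIntegral_map (hC.prod .univ) hψY (hH.prodMk hζ), Set.mk_preimage_prod,
          Set.preimage_univ, Set.inter_univ]
    _ = ∫⁻ h in C, ∫⁻ z, ψ (Y h) z ∂(condDistrib ζ H Pr h) ∂(Pr.map H) := by
        rw [← compProd_map_condDistrib hζ.aemeasurable,
          Measure.setLIntegral_compProd hψY hC .univ]
        simp only [Measure.restrict_univ]
    _ ≤ ∫⁻ h in C, χ (Y h) ∂(Pr.map H) :=
        lintegral_mono_ae (ae_restrict_of_ae (hle.mono fun h hh => hh (Y h)))
    _ ≤ ∫⁻ ω in H ⁻¹' C, χ (Y (H ω)) ∂Pr := by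
        rw [Measure.restrict_map hH hC]
        exact lintegral_map_le _ _

end ConditionalLaw

section Past

variable {Ω 𝓐 Z E : Type*}

/-- What is known before the sample number `k` of the sequence `ζ`: the value of `A`, which is
known at the outset, and the samples before number `k`. -/
def past (A : Ω → 𝓐) (ζ : ℕ → Ω → Z) (k : ℕ) (ω : Ω) : 𝓐 × (Fin k → Z) :=
  (A ω, fun j => ζ j ω)

/-- The iterates of the stochastic gradient recursion driven by the estimator `g` and the noise
sequence `z`; the step from the iterate number `k` uses `z k` and the stepsize `γ (k + 1)`. -/
def sgIterate [AddCommGroup E] [Module ℝ E] (γ : ℕ → ℝ) (g : E → Z → E) (x₁ : E) (z : ℕ → Z) :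
    ℕ → E
  | 0 => x₁
  | k + 1 => sgIterate γ g x₁ z k - γ (k + 1) • g (sgIterate γ g x₁ z k) (z k)

variable [m𝓐 : MeasurableSpace 𝓐] [MeasurableSpace Z] {A : Ω → 𝓐} {ζ : ℕ → Ω → Z}

lemma measurable_comap_past_init (k : ℕ) :
    Measurable[MeasurableSpace.comap (past A ζ k) inferInstance] A :=
  measurable_fst.comp (comap_measurable (past A ζ k))

lemma measurable_comap_past_sample {j k : ℕ} (hjk : j < k) :
    Measurable[MeasurableSpace.comap (past A ζ k) inferInstance] (ζ j) :=
  ((measurable_pi_apply (⟨j, hjk⟩ : Fin k)).comp measurable_snd).comp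
    (comap_measurable (past A ζ k))

lemma comap_init_le_comap_past (k : ℕ) :
    m𝓐.comap A ≤ MeasurableSpace.comap (past A ζ k) inferInstance :=
  (measurable_comap_past_init k).comap_le

lemma comap_past_mono {j k : ℕ} (hjk : j ≤ k) :
    MeasurableSpace.comap (past A ζ j) inferInstance ≤
      MeasurableSpace.comap (past A ζ k) inferInstance := by
  let _ : MeasurableSpace Ω := MeasurableSpace.comap (past A ζ k) inferInstance
  exact ((measurable_comap_past_init k).prodMk <| measurable_pi_lambda _ fun i =>
    measurable_comap_past_sample (i.2.trans_le hjk)).comap_le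

variable [AddCommGroup E] [MeasurableSpace E] {g : E → Z → E}

lemma measurable_comap_past_sum_sub [MeasurableAdd₂ E] [MeasurableSub₂ E] {m : E → E}
    (hg : Measurable (Function.uncurry g)) (hm : Measurable m) {X : Ω → E}
    (hX : Measurable[m𝓐.comap A] X) (k : ℕ) :
    Measurable[MeasurableSpace.comap (past A ζ k) inferInstance]
      fun ω => ∑ j ∈ Finset.range k, (g (X ω) (ζ j ω) - m (X ω)) := by
  let _ : MeasurableSpace Ω := MeasurableSpace.comap (past A ζ k) inferInstance
  have hX_past : Measurable X := hX.mono (comap_init_le_comap_past k) le_rfl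
  refine Finset.measurable_sum _ fun j hj => Measurable.sub ?_ (hm.comp hX_past)
  exact hg.comp (hX_past.prodMk (measurable_comap_past_sample (Finset.mem_range.1 hj)))

lemma measurable_comap_past_sgIterate [Module ℝ E] [MeasurableSub₂ E] [MeasurableConstSMul ℝ E]
    (γ : ℕ → ℝ) (hg : Measurable (Function.uncurry g)) (x₁ : E) (k : ℕ) :
    Measurable[MeasurableSpace.comap (past A ζ k) inferInstance]
      fun ω => sgIterate γ g x₁ (fun j => ζ j ω) k := by
  induction k with
  | zero => exact measurable_const
  | succ k ih =>
    let _ : MeasurableSpace Ω := MeasurableSpace.comap (past A ζ (k + 1)) inferInstance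
    have hiterate := ih.mono (comap_past_mono k.le_succ) le_rfl
    exact hiterate.sub <| .const_smul
      (hg.comp (hiterate.prodMk (measurable_comap_past_sample k.lt_succ_self))) (γ (k + 1))

end Past

section EstimatorStream

variable {Ω 𝓐 Z E : Type*} [MeasurableSpace Ω] [MeasurableSpace 𝓐] [MeasurableSpace Z]
  {A : Ω → 𝓐} {ζ : ℕ → Ω → Z}

lemma measurable_past (hA : Measurable A) (hζ : ∀ k, Measurable (ζ k)) (k : ℕ) :
    Measurable (past A ζ k) := by
  unfold past
  fun_prop

variable [StandardBorelSpace Z] [Nonempty Z]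

/-- The first `K` samples of `ζ` are such that, given the past, `g` estimates `m` with second
moment at most `V`. -/
structure IsEstimatorStream [NormedAddCommGroup E] [NormedSpace ℝ E] (g : E → Z → E) (m : E → E)
    (V : E → ℝ) (A : Ω → 𝓐) (ζ : ℕ → Ω → Z) (K : ℕ) (Pr : Measure Ω) [IsFiniteMeasure Pr] :
    Prop where
  measurable_init : Measurable A
  measurable_sample : ∀ k, Measurable (ζ k)
  isEstimator : ∀ k < K, ∀ᵐ h ∂(Pr.map (past A ζ k)),
    IsEstimator g m V (condDistrib (ζ k) (past A ζ k) Pr h)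

end EstimatorStream

section Averaging

open scoped ENNReal

variable {Z E : Type*} [MeasurableSpace Z] [NormedAddCommGroup E] [InnerProductSpace ℝ E]
  [CompleteSpace E] {g : E → Z → E} {m : E → E} {V : E → ℝ}

lemma IsEstimator.integral_norm_add_sub_sq_le {ν : Measure Z} [IsProbabilityMeasure ν]
    (hg : IsEstimator g m V ν) (a x : E) :
    ∫ z, ‖a + (g x z - m x)‖ ^ 2 ∂ν ≤ ‖a‖ ^ 2 + V x := by
  rw [← hg.integral_eq x, integral_norm_add_sub_mean_sq (hg.memLp x)]
  linarith [hg.integral_norm_sq_le x, sq_nonneg ‖∫ z, g x z ∂ν‖]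

lemma IsEstimator.lintegral_norm_add_sub_sq_le {ν : Measure Z} [IsProbabilityMeasure ν]
    (hg : IsEstimator g m V ν) (a x : E) :
    ∫⁻ z, ENNReal.ofReal (‖a + (g x z - m x)‖ ^ 2) ∂ν ≤
      ENNReal.ofReal (‖a‖ ^ 2) + ENNReal.ofReal (V x) := by
  have hint : Integrable (fun z => ‖a + (g x z - m x)‖ ^ 2) ν :=
    ((memLp_const a).add ((hg.memLp x).sub (memLp_const (m x)))).integrable_norm_pow'
  rw [← ofReal_integral_eq_lintegral_ofReal hint (.of_forall fun z => by positivity)]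
  exact (ENNReal.ofReal_le_ofReal (hg.integral_norm_add_sub_sq_le a x)).trans
    ENNReal.ofReal_add_le

variable {Ω 𝓐 : Type*} [m𝓐 : MeasurableSpace 𝓐] [MeasurableSpace Ω] [StandardBorelSpace Z]
  [Nonempty Z] [MeasurableSpace E] [BorelSpace E] [SecondCountableTopology E]
  {A : Ω → 𝓐} {ζ : ℕ → Ω → Z} {K : ℕ} {Pr : Measure Ω} [IsFiniteMeasure Pr]

lemma IsEstimatorStream.lintegral_norm_sum_sub_sq_le (hζ : IsEstimatorStream g m V A ζ K Pr)
    (hg_meas : Measurable (Function.uncurry g)) (hm : Measurable m) {X : Ω → E}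
    (hX : Measurable[m𝓐.comap A] X) {k : ℕ} (hk : k ≤ K) :
    ∫⁻ ω, ENNReal.ofReal (‖∑ j ∈ Finset.range k, (g (X ω) (ζ j ω) - m (X ω))‖ ^ 2) ∂Pr ≤
      k * ∫⁻ ω, ENNReal.ofReal (V (X ω)) ∂Pr := by
  induction k with
  | zero => simp
  | succ k ih =>
    have hpast := measurable_past hζ.measurable_init hζ.measurable_sample k
    have hsum := measurable_comap_past_sum_sub (ζ := ζ) hg_meas hm hX k
    have hstep := setLIntegral_comp_le_of_condDistrib (Pr := Pr) (B := Set.univ)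
      (X := fun ω => (∑ j ∈ Finset.range k, (g (X ω) (ζ j ω) - m (X ω)), X ω))
      (ψ := fun p z => ENNReal.ofReal (‖p.1 + (g p.2 z - m p.2)‖ ^ 2))
      (χ := fun p => ENNReal.ofReal (‖p.1‖ ^ 2) + ENNReal.ofReal (V p.2))
      hpast (hζ.measurable_sample k)
      (hsum.prodMk (hX.mono (comap_init_le_comap_past k) le_rfl)) .univ (by fun_prop)
      ((hζ.isEstimator k hk).mono fun h hh p => hh.lintegral_norm_add_sub_sq_le p.1 p.2)
    simp only [Measure.restrict_univ] at hstep
    simp only [Finset.sum_range_succ]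
    refine hstep.trans ?_
    rw [lintegral_add_left (by have := hsum.mono hpast.comap_le le_rfl; fun_prop), Nat.cast_succ,
      add_one_mul]
    gcongr
    exact ih (Nat.le_of_succ_le hk)

end Averaging

section Descent

open scoped ENNReal RealInnerProductSpace

/-- The factor of `‖∇f(x)‖²` in the expected decrease of `f` over a step of size `t` from `x`, where
the second moment of the gradient estimate at `x` is at most `a ‖∇f(x)‖² + b`. -/
noncomputable def descentGain (L a t : ℝ) : ℝ := (t - a * L * t ^ 2) / 2

/-- The part of the expected change of `f` over a step of size `t` that is due to the noise and to
the bias of the gradient estimate, whose squared norm is at most `β`. -/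
noncomputable def descentLoss (L b β t : ℝ) : ℝ := (t * β + L * t ^ 2 * b) / 2

variable {Z E : Type*} [NormedAddCommGroup E] [InnerProductSpace ℝ E] {f : E → ℝ}

lemma sub_smul_le_of_le_quadratic {L : ℝ} {x v : E}
    (hf_upper : ∀ w, f (x + w) ≤ f x + ⟪v, w⟫ + L / 2 * ‖w‖ ^ 2) (w : E) (t : ℝ) :
    f (x - t • w) ≤ f x + (-t * ⟪v, w⟫ + L / 2 * t ^ 2 * ‖w‖ ^ 2) := by
  have hupper := hf_upper (-(t • w))
  rw [inner_neg_right, real_inner_smul_right, norm_neg, norm_smul, mul_pow, Real.norm_eq_abs,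
    sq_abs, ← sub_eq_add_neg] at hupper
  linarith

variable [MeasurableSpace Z] [CompleteSpace E] {g : E → Z → E} {m : E → E} {L a b β lower : ℝ}

lemma IsEstimator.integral_descent_le {ν : Measure Z} [IsProbabilityMeasure ν]
    (hg : IsEstimator g m (fun x => a * ‖gradient f x‖ ^ 2 + b) ν) (hL : 0 ≤ L)
    {x : E} (hbias : ‖m x - gradient f x‖ ^ 2 ≤ β) {t : ℝ} (ht : 0 ≤ t) :
    ∫ z, (-t * ⟪gradient f x, g x z⟫ + L / 2 * t ^ 2 * ‖g x z‖ ^ 2) ∂ν ≤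
      descentLoss L b β t - descentGain L a t * ‖gradient f x‖ ^ 2 := by
  have hint := (hg.memLp x).integrable one_le_two
  rw [integral_add ((hint.const_inner _).const_mul _)
    ((hg.memLp x).integrable_norm_pow'.const_mul _), integral_const_mul, integral_const_mul,
    integral_inner hint, hg.integral_eq]
  have hpolar : -⟪gradient f x, m x⟫ ≤ (β - ‖gradient f x‖ ^ 2) / 2 := by
    rw [norm_sub_sq_real, real_inner_comm] at hbias
    linarith [sq_nonneg ‖m x‖]
  calc _ ≤ t * ((β - ‖gradient f x‖ ^ 2) / 2) +
          L / 2 * t ^ 2 * (a * ‖gradient f x‖ ^ 2 + b) := by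
        rw [neg_mul_comm]
        gcongr
        exact hg.integral_norm_sq_le x
    _ = _ := by rw [descentLoss, descentGain]; ring

lemma IsEstimator.lintegral_descent_le {ν : Measure Z} [IsProbabilityMeasure ν]
    (hg : IsEstimator g m (fun x => a * ‖gradient f x‖ ^ 2 + b) ν) (hL : 0 ≤ L)
    (hf_upper : ∀ x v, f (x + v) ≤ f x + ⟪gradient f x, v⟫ + L / 2 * ‖v‖ ^ 2)
    (hf_lower : ∀ x, lower ≤ f x) {x : E} (hbias : ‖m x - gradient f x‖ ^ 2 ≤ β) {t : ℝ}
    (ht : 0 ≤ t) (hgain : 0 ≤ descentGain L a t) :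
    ∫⁻ z, ENNReal.ofReal (f (x - t • g x z) - lower) ∂ν +
        ENNReal.ofReal (descentGain L a t) * ENNReal.ofReal (‖gradient f x‖ ^ 2) ≤
      ENNReal.ofReal (f x - lower) + ENNReal.ofReal (descentLoss L b β t) := by
  have hstep (z : Z) : f (x - t • g x z) - lower ≤
      f x - lower + (-t * ⟪gradient f x, g x z⟫ + L / 2 * t ^ 2 * ‖g x z‖ ^ 2) := by
    linarith [sub_smul_le_of_le_quadratic (hf_upper x) (g x z) t]
  have hchange_int : Integrable
      (fun z => -t * ⟪gradient f x, g x z⟫ + L / 2 * t ^ 2 * ‖g x z‖ ^ 2) ν :=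
    ((((hg.memLp x).integrable one_le_two).const_inner _).const_mul _).add
      ((hg.memLp x).integrable_norm_pow'.const_mul _)
  have hbound_int : Integrable
      (fun z => f x - lower + (-t * ⟪gradient f x, g x z⟫ + L / 2 * t ^ 2 * ‖g x z‖ ^ 2)) ν :=
    (integrable_const (f x - lower)).add hchange_int
  have hbound_nonneg (z : Z) := (sub_nonneg.2 (hf_lower (x - t • g x z))).trans (hstep z)
  have hmean : ∫ z, (f x - lower + (-t * ⟪gradient f x, g x z⟫ + L / 2 * t ^ 2 * ‖g x z‖ ^ 2)) ∂ν
      ≤ f x - lower + (descentLoss L b β t - descentGain L a t * ‖gradient f x‖ ^ 2) := by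
    rw [integral_add (integrable_const _) hchange_int, integral_const, probReal_univ, one_smul]
    gcongr
    exact hg.integral_descent_le hL hbias ht
  calc _ ≤ ENNReal.ofReal (f x - lower +
            (descentLoss L b β t - descentGain L a t * ‖gradient f x‖ ^ 2)) +
          ENNReal.ofReal (descentGain L a t * ‖gradient f x‖ ^ 2) := by
        rw [← ENNReal.ofReal_mul hgain]
        gcongr
        refine (lintegral_mono fun z => ENNReal.ofReal_le_ofReal (hstep z)).trans ?_
        rw [← ofReal_integral_eq_lintegral_ofReal hbound_int (.of_forall hbound_nonneg)]
        exact ENNReal.ofReal_le_ofReal hmean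
    _ = ENNReal.ofReal (f x - lower + descentLoss L b β t) := by
        rw [← ENNReal.ofReal_add ((integral_nonneg hbound_nonneg).trans hmean) (by positivity)]
        ring_nf
    _ ≤ _ := ENNReal.ofReal_add_le

variable {Ω 𝓐 : Type*} [m𝓐 : MeasurableSpace 𝓐] [MeasurableSpace Ω] [StandardBorelSpace Z]
  [Nonempty Z] [MeasurableSpace E] [BorelSpace E] [SecondCountableTopology E]
  {A : Ω → 𝓐} {ζ : ℕ → Ω → Z} {K : ℕ} {Pr : Measure Ω} [IsFiniteMeasure Pr] {γ : ℕ → ℝ}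

lemma IsEstimatorStream.setLIntegral_step_le
    (hζ : IsEstimatorStream g m (fun x => a * ‖gradient f x‖ ^ 2 + b) A ζ K Pr) (hL : 0 ≤ L)
    (hf : Measurable f) (hf' : Measurable (gradient f))
    (hf_upper : ∀ x v, f (x + v) ≤ f x + ⟪gradient f x, v⟫ + L / 2 * ‖v‖ ^ 2)
    (hf_lower : ∀ x, lower ≤ f x) (hbias : ∀ x, ‖m x - gradient f x‖ ^ 2 ≤ β)
    (hg : Measurable (Function.uncurry g)) (x₁ : E) {k : ℕ} (hk : k < K) (hγ : 0 ≤ γ (k + 1))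
    (hgain : 0 ≤ descentGain L a (γ (k + 1))) {B : Set Ω} (hB : MeasurableSet[m𝓐.comap A] B) :
    ∫⁻ ω in B, ENNReal.ofReal (f (sgIterate γ g x₁ (fun j => ζ j ω) (k + 1)) - lower) ∂Pr +
        ENNReal.ofReal (descentGain L a (γ (k + 1))) * ∫⁻ ω in B,
          ENNReal.ofReal (‖gradient f (sgIterate γ g x₁ (fun j => ζ j ω) k)‖ ^ 2) ∂Pr ≤
      ∫⁻ ω in B, ENNReal.ofReal (f (sgIterate γ g x₁ (fun j => ζ j ω) k) - lower) ∂Pr +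
        ENNReal.ofReal (descentLoss L b β (γ (k + 1))) * Pr B := by
  have hpast := measurable_past hζ.measurable_init hζ.measurable_sample k
  have hX := measurable_comap_past_sgIterate (A := A) (ζ := ζ) γ hg x₁ k
  have hX_meas := hX.mono hpast.comap_le le_rfl
  set t := γ (k + 1)
  have hψ : Measurable (Function.uncurry fun x z => ENNReal.ofReal (f (x - t • g x z) - lower) +
      ENNReal.ofReal (descentGain L a t) * ENNReal.ofReal (‖gradient f x‖ ^ 2)) := by
    have hpoint : Measurable fun p : E × Z => p.1 - t • g p.1 p.2 :=
      measurable_fst.sub (hg.const_smul t)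
    exact ((hf.comp hpoint).sub_const lower).ennreal_ofReal.add (by fun_prop)
  have hstep := setLIntegral_comp_le_of_condDistrib (Pr := Pr)
    (χ := fun x => ENNReal.ofReal (f x - lower) + ENNReal.ofReal (descentLoss L b β t))
    hpast (hζ.measurable_sample k) hX (comap_init_le_comap_past k _ hB) hψ <| by
      filter_upwards [hζ.isEstimator k hk] with h hh x
      rw [lintegral_add_right _ measurable_const, lintegral_const, measure_univ, mul_one]
      exact hh.lintegral_descent_le hL hf_upper hf_lower (hbias x) hγ hgain
  rw [lintegral_add_right _ (by fun_prop), lintegral_add_right _ measurable_const,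
    setLIntegral_const, lintegral_const_mul _ (by fun_prop)] at hstep
  exact hstep

lemma IsEstimatorStream.sum_setLIntegral_sq_gradient_le
    (hζ : IsEstimatorStream g m (fun x => a * ‖gradient f x‖ ^ 2 + b) A ζ K Pr) (hL : 0 ≤ L)
    (hf : Measurable f) (hf' : Measurable (gradient f))
    (hf_upper : ∀ x v, f (x + v) ≤ f x + ⟪gradient f x, v⟫ + L / 2 * ‖v‖ ^ 2)
    (hf_lower : ∀ x, lower ≤ f x) (hbias : ∀ x, ‖m x - gradient f x‖ ^ 2 ≤ β)
    (hg : Measurable (Function.uncurry g)) (x₁ : E) (hγ : ∀ k, 0 ≤ γ k)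
    (hgain : ∀ k, 0 ≤ descentGain L a (γ k)) {B : Set Ω} (hB : MeasurableSet[m𝓐.comap A] B) :
    ∑ k ∈ Finset.range K, ENNReal.ofReal (descentGain L a (γ (k + 1))) * ∫⁻ ω in B,
        ENNReal.ofReal (‖gradient f (sgIterate γ g x₁ (fun j => ζ j ω) k)‖ ^ 2) ∂Pr ≤
      (ENNReal.ofReal (f x₁ - lower) +
        ∑ k ∈ Finset.range K, ENNReal.ofReal (descentLoss L b β (γ (k + 1)))) * Pr B := by
  suffices htelescope : ∀ k ≤ K,
      ∫⁻ ω in B, ENNReal.ofReal (f (sgIterate γ g x₁ (fun j => ζ j ω) k) - lower) ∂Pr +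
        ∑ k ∈ Finset.range k, ENNReal.ofReal (descentGain L a (γ (k + 1))) * ∫⁻ ω in B,
          ENNReal.ofReal (‖gradient f (sgIterate γ g x₁ (fun j => ζ j ω) k)‖ ^ 2) ∂Pr ≤
        (ENNReal.ofReal (f x₁ - lower) +
          ∑ k ∈ Finset.range k, ENNReal.ofReal (descentLoss L b β (γ (k + 1)))) * Pr B from
    le_add_self.trans (htelescope K le_rfl)
  intro k hk
  induction k with
  | zero => simp [sgIterate]
  | succ k ih =>
    have hstep := hζ.setLIntegral_step_le hL hf hf' hf_upper hf_lower hbias hg x₁ hk (hγ _)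
      (hgain _) hB
    rw [Finset.sum_range_succ, Finset.sum_range_succ, ← add_assoc (ENNReal.ofReal _), add_mul,
      add_comm (∑ _ ∈ _, _), ← add_assoc]
    refine (add_le_add_left hstep _).trans ?_
    rw [add_right_comm]
    exact add_le_add_left (ih (Nat.le_of_succ_le hk)) _

end Descent

section RandomIndex

open scoped ENNReal

variable {Ω 𝓗 : Type*} [MeasurableSpace Ω] [m𝓗 : MeasurableSpace 𝓗] {Pr : Measure Ω} {H : Ω → 𝓗}
  {R : Ω → ℕ}

lemma setLIntegral_indepFun_index {s : Finset ℕ} {Y : ℕ → Ω → ℝ≥0∞} {B : Set Ω}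
    (hH : Measurable H) (hR : Measurable R) (hindep : IndepFun R H Pr) (hRs : ∀ ω, R ω ∈ s)
    (hY : ∀ k ∈ s, Measurable[m𝓗.comap H] (Y k)) (hB : MeasurableSet[m𝓗.comap H] B) :
    ∫⁻ ω in B, Y (R ω) ω ∂Pr = ∑ k ∈ s, Pr {ω | R ω = k} * ∫⁻ ω in B, Y k ω ∂Pr := by
  have hB' := hH.comap_le _ hB
  have hlevel (k : ℕ) : MeasurableSet {ω | R ω = k} := hR (.singleton k)
  have hindicator (k : ℕ) : Measurable[MeasurableSpace.comap R inferInstance]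
      ({ω | R ω = k}.indicator (1 : Ω → ℝ≥0∞)) :=
    (measurable_const.indicator (.singleton k)).comp (comap_measurable R)
  have hsplit (ω : Ω) : B.indicator (fun ω => Y (R ω) ω) ω =
      ∑ k ∈ s, {ω | R ω = k}.indicator 1 ω * B.indicator (Y k) ω := by
    rw [Finset.sum_eq_single_of_mem (R ω) (hRs ω) fun k _ hk => by
      rw [Set.indicator_of_notMem (by exact hk.symm), zero_mul]]
    by_cases hω : ω ∈ B <;> simp [hω]
  simp only [← lintegral_indicator hB', hsplit]
  rw [lintegral_finsetSum' _ fun k hk => ?_]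
  · refine Finset.sum_congr rfl fun k hk => ?_
    rw [lintegral_mul_eq_lintegral_mul_lintegral_of_independent_measurableSpace hR.comap_le
      hH.comap_le hindep (hindicator k) ((hY k hk).indicator hB),
      lintegral_indicator_one (hlevel k)]
  · exact ((measurable_one.indicator (hlevel k)).mul
      (((hY k hk).mono hH.comap_le le_rfl).indicator hB')).aemeasurable

end RandomIndex

section RandomIterate

open scoped ENNReal RealInnerProductSpace

variable {Ω 𝓐 Z E : Type*} [MeasurableSpace Ω] [m𝓐 : MeasurableSpace 𝓐] [MeasurableSpace Z]
  [StandardBorelSpace Z] [Nonempty Z] [NormedAddCommGroup E] [InnerProductSpace ℝ E]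
  [CompleteSpace E] [MeasurableSpace E] [BorelSpace E] [SecondCountableTopology E]
  {f : E → ℝ} {g : E → Z → E} {m : E → E} {L a b β lower : ℝ}
  {A : Ω → 𝓐} {ζ : ℕ → Ω → Z} {K : ℕ} {Pr : Measure Ω} [IsFiniteMeasure Pr] {γ : ℕ → ℝ}

lemma IsEstimatorStream.setLIntegral_sq_gradient_random_le
    (hζ : IsEstimatorStream g m (fun x => a * ‖gradient f x‖ ^ 2 + b) A ζ K Pr) (hL : 0 ≤ L)
    (hf : Measurable f) (hf' : Measurable (gradient f))
    (hf_upper : ∀ x v, f (x + v) ≤ f x + ⟪gradient f x, v⟫ + L / 2 * ‖v‖ ^ 2)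
    (hf_lower : ∀ x, lower ≤ f x) (hbias : ∀ x, ‖m x - gradient f x‖ ^ 2 ≤ β)
    (hg : Measurable (Function.uncurry g)) (x₁ : E) (hγ : ∀ k, 0 ≤ γ k)
    (hgain : ∀ k, 0 ≤ descentGain L a (γ k)) (hloss : ∀ k, 0 ≤ descentLoss L b β (γ k))
    (hgain_sum : 0 < ∑ k ∈ Finset.range K, descentGain L a (γ (k + 1))) {J : Ω → ℕ}
    (hJ : Measurable J) (hJ_lt : ∀ ω, J ω < K) (hJ_indep : IndepFun J (past A ζ K) Pr)
    (hJ_law : ∀ k < K, Pr.real {ω | J ω = k} =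
      descentGain L a (γ (k + 1)) / ∑ j ∈ Finset.range K, descentGain L a (γ (j + 1)))
    {B : Set Ω} (hB : MeasurableSet[m𝓐.comap A] B) :
    ∫⁻ ω in B, ENNReal.ofReal
        (‖gradient f (sgIterate γ g x₁ (fun j => ζ j ω) (J ω))‖ ^ 2) ∂Pr ≤
      ENNReal.ofReal ((f x₁ - lower + ∑ k ∈ Finset.range K, descentLoss L b β (γ (k + 1))) /
        ∑ k ∈ Finset.range K, descentGain L a (γ (k + 1))) * Pr B := by
  set G := ∑ k ∈ Finset.range K, descentGain L a (γ (k + 1))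
  have hiterate (k : ℕ) (hk : k ∈ Finset.range K) :
      Measurable[MeasurableSpace.comap (past A ζ K) inferInstance] fun ω =>
        ENNReal.ofReal (‖gradient f (sgIterate γ g x₁ (fun j => ζ j ω) k)‖ ^ 2) :=
    ((hf'.norm.pow_const 2).ennreal_ofReal.comp (measurable_comap_past_sgIterate γ hg x₁ k)).mono
      (comap_past_mono (Finset.mem_range.1 hk).le) le_rfl
  have hlaw (k : ℕ) (hk : k ∈ Finset.range K) : Pr {ω | J ω = k} =
      ENNReal.ofReal G⁻¹ * ENNReal.ofReal (descentGain L a (γ (k + 1))) := by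
    rw [← ofReal_measureReal, hJ_law k (Finset.mem_range.1 hk), div_eq_inv_mul,
      ENNReal.ofReal_mul (inv_nonneg.2 hgain_sum.le)]
  calc _ = ENNReal.ofReal G⁻¹ * ∑ k ∈ Finset.range K,
          ENNReal.ofReal (descentGain L a (γ (k + 1))) * ∫⁻ ω in B,
            ENNReal.ofReal (‖gradient f (sgIterate γ g x₁ (fun j => ζ j ω) k)‖ ^ 2) ∂Pr := by
        rw [setLIntegral_indepFun_index
          (measurable_past hζ.measurable_init hζ.measurable_sample K) hJ hJ_indep
          (fun ω => Finset.mem_range.2 (hJ_lt ω)) hiterate (comap_init_le_comap_past K _ hB),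
          Finset.mul_sum]
        exact Finset.sum_congr rfl fun k hk => by rw [hlaw k hk, mul_assoc]
    _ ≤ ENNReal.ofReal G⁻¹ * ((ENNReal.ofReal (f x₁ - lower) +
          ∑ k ∈ Finset.range K, ENNReal.ofReal (descentLoss L b β (γ (k + 1)))) * Pr B) := by
        gcongr
        exact hζ.sum_setLIntegral_sq_gradient_le hL hf hf' hf_upper hf_lower hbias hg x₁ hγ hgain
          hB
    _ = _ := by
        rw [← ENNReal.ofReal_sum_of_nonneg fun k _ => hloss _,
          ← ENNReal.ofReal_add (sub_nonneg.2 (hf_lower x₁))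
            (Finset.sum_nonneg fun k _ => hloss _),
          ← mul_assoc, ← ENNReal.ofReal_mul (inv_nonneg.2 hgain_sum.le), ← div_eq_inv_mul]

end RandomIterate

section Stepsize

variable {n : ℕ} {L σ D Δ μ : ℝ} {N : ℕ}

lemma stepsize_pos (hL : 0 < L) (hσ : 0 ≤ σ) (hD : 0 < D) (hN : 0 < N) (k : ℕ) :
    0 < stepsize n L σ D N k := by
  unfold stepsize
  split_ifs with hσ_eq
  · positivity
  · have := hσ.lt_of_ne' hσ_eq
    positivity

lemma mul_stepsize_le_one (hL : 0 < L) (k : ℕ) : 4 * L * (n + 4) * stepsize n L σ D N k ≤ 1 := by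
  have hsqrt : √((n : ℝ) + 4) ^ 2 = n + 4 := Real.sq_sqrt (by positivity)
  calc _ ≤ 4 * L * (n + 4) * (1 / √((n : ℝ) + 4) * (1 / (4 * L * √((n : ℝ) + 4)))) := by
        unfold stepsize
        gcongr
        split_ifs
        · exact le_rfl
        · exact min_le_left _ _
    _ = 1 := by field_simp; exact hsqrt.symm

lemma stepsize_mul_le (hσ : 0 ≤ σ) (hD : 0 < D) (hN : 0 < N) (k : ℕ) :
    stepsize n L σ D N k * (σ * √((n : ℝ) + 4) * √(N : ℝ)) ≤ D := by
  rcases hσ.eq_or_lt' with rfl | hσ_pos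
  · simp [hD.le]
  calc _ ≤ 1 / √((n : ℝ) + 4) * (D / (σ * √(N : ℝ))) * (σ * √((n : ℝ) + 4) * √(N : ℝ)) := by
        unfold stepsize
        rw [if_neg hσ_pos.ne']
        gcongr
        exact min_le_right _ _
    _ = D := by field_simp

lemma one_le_stepsize_mul (hL : 0 < L) (hσ : 0 ≤ σ) (hD : 0 < D) (hN : 0 < N) (k : ℕ) :
    1 ≤ stepsize n L σ D N k * (4 * L * (n + 4) + σ * √((n : ℝ) + 4) * √(N : ℝ) / D) := by
  have hpos := stepsize_pos (n := n) hL hσ hD hN k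
  have hsqrt : √((n : ℝ) + 4) ^ 2 = n + 4 := Real.sq_sqrt (by positivity)
  have hcurvature :
      1 / √((n : ℝ) + 4) * (1 / (4 * L * √((n : ℝ) + 4))) * (4 * L * (n + 4)) = 1 := by
    field_simp
    exact hsqrt.symm
  have hcurvature_nonneg : 0 ≤ stepsize n L σ D N k * (4 * L * (n + 4)) := by positivity
  have hnoise_nonneg :
      0 ≤ stepsize n L σ D N k * (σ * √((n : ℝ) + 4) * √(N : ℝ) / D) := by positivity
  rw [mul_add]
  unfold stepsize at hcurvature_nonneg hnoise_nonneg ⊢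
  split_ifs at hcurvature_nonneg hnoise_nonneg ⊢ with hσ_eq
  · linarith
  rcases min_choice (1 / (4 * L * √((n : ℝ) + 4))) (D / (σ * √(N : ℝ))) with hmin | hmin
  · rw [hmin] at hcurvature_nonneg hnoise_nonneg ⊢
    linarith
  · rw [hmin] at hcurvature_nonneg hnoise_nonneg ⊢
    have hnoise : 1 / √((n : ℝ) + 4) * (D / (σ * √(N : ℝ))) *
        (σ * √((n : ℝ) + 4) * √(N : ℝ) / D) = 1 := by field_simp
    linarith

lemma probR_add_one (n : ℕ) (L : ℝ) (γ : ℕ → ℝ) (N k : ℕ) :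
    probR n L γ N (k + 1) = descentGain L (2 * (n + 4)) (γ (k + 1)) /
      ∑ j ∈ Finset.range N, descentGain L (2 * (n + 4)) (γ (j + 1)) := by
  have hgain (t : ℝ) : t - 2 * L * (n + 4) * t ^ 2 = 2 * descentGain L (2 * (n + 4)) t := by
    rw [descentGain]; ring
  rw [probR, ← Finset.Ico_succ_right_eq_Icc, Nat.succ_eq_succ, Finset.sum_Ico_eq_sum_range]
  simp only [hgain, ← Finset.mul_sum, Nat.succ_sub_one, add_comm 1]
  rw [mul_div_mul_left _ _ two_ne_zero]

lemma descentLoss_nonneg {b β t : ℝ} (hL : 0 ≤ L) (hb : 0 ≤ b) (hβ : 0 ≤ β) (ht : 0 ≤ t) :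
    0 ≤ descentLoss L b β t := by
  unfold descentLoss; positivity

lemma stepsize_div_four_le_descentGain (hL : 0 < L) (hσ : 0 ≤ σ) (hD : 0 < D) (hN : 0 < N)
    (k : ℕ) :
    stepsize n L σ D N k / 4 ≤ descentGain L (2 * (n + 4)) (stepsize n L σ D N k) := by
  unfold descentGain
  nlinarith [mul_stepsize_le_one (n := n) (σ := σ) (D := D) (N := N) hL k,
    stepsize_pos (n := n) hL hσ hD hN k]

lemma mul_Bbar_mul (hN : 0 < N) (t : ℝ) :
    L * Bbar n L σ D Δ N * (N * (t / 4)) = 3 * (t * ((n + 4) * L ^ 2 * Δ ^ 2)) +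
      t * L * (σ * √((n : ℝ) + 4) * √(N : ℝ)) * (D + Δ ^ 2 / D) := by
  have hsqrt : (N : ℝ) = √(N : ℝ) ^ 2 := (Real.sq_sqrt N.cast_nonneg).symm
  have hfirst : 12 * ((n : ℝ) + 4) * L * Δ ^ 2 / N * N = 12 * ((n : ℝ) + 4) * L * Δ ^ 2 := by
    field_simp
  have hsecond : 4 * σ * √((n : ℝ) + 4) / √(N : ℝ) * N =
      4 * (σ * √((n : ℝ) + 4) * √(N : ℝ)) := by
    nth_rw 2 [hsqrt]
    field_simp
  calc _ = L * (t / 4) * (12 * ((n : ℝ) + 4) * L * Δ ^ 2 / N * N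
          + (4 * σ * √((n : ℝ) + 4) / √(N : ℝ) * N) * (D + Δ ^ 2 / D)) := by rw [Bbar]; ring
    _ = _ := by rw [hfirst, hsecond]; ring

lemma initial_gap_le_stepsize_mul (hL : 0 < L) (hσ : 0 ≤ σ) (hD : 0 < D) (hN : 0 < N) (k : ℕ) :
    L * Δ ^ 2 / 2 ≤ stepsize n L σ D N k *
      (2 * ((n + 4) * L ^ 2 * Δ ^ 2) + L * (σ * √((n : ℝ) + 4) * √(N : ℝ)) * (Δ ^ 2 / D)) := by
  have hpos := stepsize_pos (n := n) hL hσ hD hN k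
  have hslack : 0 ≤ stepsize n L σ D N k *
      (L * (σ * √((n : ℝ) + 4) * √(N : ℝ)) * (Δ ^ 2 / D)) := by positivity
  have hscaled := mul_le_mul_of_nonneg_left (one_le_stepsize_mul (n := n) hL hσ hD hN k)
    (by positivity : 0 ≤ L * Δ ^ 2 / 2)
  calc _ ≤ L * Δ ^ 2 / 2 * (stepsize n L σ D N k *
          (4 * L * (n + 4) + σ * √((n : ℝ) + 4) * √(N : ℝ) / D)) := by rwa [mul_one] at hscaled
    _ = stepsize n L σ D N k * (2 * ((n + 4) * L ^ 2 * Δ ^ 2)) + stepsize n L σ D N k *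
          (L * (σ * √((n : ℝ) + 4) * √(N : ℝ)) * (Δ ^ 2 / D)) / 2 := by ring
    _ ≤ _ := by linarith

lemma mul_descentLoss_stepsize_le (hL : 0 < L) (hσ : 0 ≤ σ) (hD : 0 < D) (hN : 0 < N)
    (hμ : N * smoothingError n L μ ≤ (n + 4) * L ^ 2 * Δ ^ 2 / 8) (k : ℕ) :
    N * descentLoss L (noiseLevel n L σ μ) (smoothingError n L μ) (stepsize n L σ D N k) ≤
      stepsize n L σ D N k *
        ((n + 4) * L ^ 2 * Δ ^ 2 + L * (σ * √((n : ℝ) + 4) * √(N : ℝ)) * D) := by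
  have hpos := stepsize_pos (n := n) hL hσ hD hN k
  have hcurvature := mul_stepsize_le_one (n := n) (σ := σ) (D := D) (N := N) hL k
  have hnoise := stepsize_mul_le (n := n) (L := L) hσ hD hN k
  set t := stepsize n L σ D N k
  set q := σ * √((n : ℝ) + 4) * √(N : ℝ) with hq
  have hq_sq : q ^ 2 = N * ((n + 4) * σ ^ 2) := by
    rw [hq, mul_pow, mul_pow, Real.sq_sqrt (by positivity), Real.sq_sqrt (by positivity)]
    ring
  have hstep : L * t ≤ 1 / 2 := by nlinarith [mul_nonneg (mul_pos hL hpos).le n.cast_nonneg]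
  have hscale : 0 ≤ (n + 4) * L ^ 2 * Δ ^ 2 := by positivity
  calc _ = t * (N * smoothingError n L μ * (1 / 2 + L * t) + L * q * (t * q)) := by
        rw [descentLoss, noiseLevel]
        linear_combination -L * t ^ 2 * hq_sq
    _ ≤ t * ((n + 4) * L ^ 2 * Δ ^ 2 / 8 * (1 / 2 + 1 / 2) + L * q * D) := by gcongr
    _ ≤ _ := by
        refine mul_le_mul_of_nonneg_left ?_ hpos.le
        linarith

lemma gap_add_descentLoss_div_descentGain_le (hL : 0 < L) (hσ : 0 ≤ σ) (hD : 0 < D) (hN : 0 < N)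
    (hμ : N * smoothingError n L μ ≤ (n + 4) * L ^ 2 * Δ ^ 2 / 8) :
    (L * Δ ^ 2 / 2 + ∑ k ∈ Finset.range N, descentLoss L (noiseLevel n L σ μ)
          (smoothingError n L μ) (stepsize n L σ D N (k + 1))) /
        ∑ k ∈ Finset.range N, descentGain L (2 * (n + 4)) (stepsize n L σ D N (k + 1)) ≤
      L * Bbar n L σ D Δ N := by
  have hgain := stepsize_div_four_le_descentGain (n := n) hL hσ hD hN 0
  have hpos := stepsize_pos (n := n) hL hσ hD hN 0
  have hBbar : 0 ≤ L * Bbar n L σ D Δ N := by unfold Bbar; positivity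
  have hconst (k : ℕ) : stepsize n L σ D N (k + 1) = stepsize n L σ D N 0 := rfl
  simp only [hconst, Finset.sum_const, Finset.card_range, nsmul_eq_mul]
  rw [div_le_iff₀ (mul_pos (Nat.cast_pos.2 hN) (by linarith))]
  calc _ ≤ L * Bbar n L σ D Δ N * (N * (stepsize n L σ D N 0 / 4)) := by
        rw [mul_Bbar_mul hN]
        linarith [initial_gap_le_stepsize_mul (n := n) (Δ := Δ) hL hσ hD hN 0,
          mul_descentLoss_stepsize_le hL hσ hD hN hμ 0]
    _ ≤ _ := by gcongr

end Stepsize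

section Programs

namespace OracleProg

variable {E Ξ α β : Type*} (F : E → Ξ → ℝ)

lemma output_bind (p : OracleProg E Ξ α) (g : α → OracleProg E Ξ β) :
    (p.bind g).output F = (g (p.output F)).output F := by
  induction p with
  | ret a => rfl
  | ask x ξ _ ih => exact ih _

lemma calls_bind (p : OracleProg E Ξ α) (g : α → OracleProg E Ξ β) :
    (p.bind g).calls F = p.calls F + (g (p.output F)).calls F := by
  induction p with
  | ret a => exact (zero_add _).symm
  | ask x ξ _ ih => exact (congrArg (· + 1) (ih _)).trans (add_right_comm _ _ _)

lemma output_collect (m : ℕ) (p : Fin m → OracleProg E Ξ α) :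
    (collect m p).output F = fun i => (p i).output F := by
  induction m with
  | zero => exact Subsingleton.elim _ _
  | succ m ih =>
    simp only [collect, output_bind, ih, output]
    exact Fin.cons_self_tail fun i => (p i).output F

lemma calls_collect_le {m c : ℕ} {p : Fin m → OracleProg E Ξ α} (h : ∀ i, (p i).calls F ≤ c) :
    (collect m p).calls F ≤ m * c := by
  induction m with
  | zero => exact Nat.zero_le _
  | succ m ih =>
    simp only [collect, calls_bind, calls]
    linarith [h 0, ih fun i => h i.succ]

end OracleProg

open OracleProg

variable {n : ℕ}

local notation "𝔼" n => EuclideanSpace ℝ (Fin n)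

variable {Ξ Ω : Type*} (F : (𝔼 n) → Ξ → ℝ) (γ : ℕ → ℝ) (μ : ℝ) (x₁ : 𝔼 n)

lemma output_gradEstimate (x : 𝔼 n) (ξ : Ξ) (u : 𝔼 n) :
    (gradEstimate μ x ξ u).output F = twoPointEstimate F μ x (ξ, u) := rfl

lemma calls_gradEstimate (x : 𝔼 n) (ξ : Ξ) (u : 𝔼 n) : (gradEstimate μ x ξ u).calls F = 2 := rfl

lemma output_avgGradEstimate (T : ℕ) (x : 𝔼 n) (ξ : ℕ → Ξ) (u : ℕ → (𝔼 n)) :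
    (avgGradEstimate μ T x ξ u).output F =
      (1 / (T : ℝ)) • ∑ k ∈ Finset.range T, twoPointEstimate F μ x (ξ k, u k) := by
  simp only [avgGradEstimate, output_bind, output_collect, output_gradEstimate, output,
    Finset.sum_range]

lemma calls_avgGradEstimate_le (T : ℕ) (x : 𝔼 n) (ξ : ℕ → Ξ) (u : ℕ → (𝔼 n)) :
    (avgGradEstimate μ T x ξ u).calls F ≤ T * 2 := by
  simp only [avgGradEstimate, calls_bind, calls]
  exact calls_collect_le F fun i => (calls_gradEstimate F μ x _ _).le

lemma output_rsgfSteps (ξ : ℕ → Ξ) (u : ℕ → (𝔼 n)) (k : ℕ) :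
    (rsgfSteps γ μ x₁ ξ u k).output F =
      sgIterate γ (twoPointEstimate F μ) x₁ (fun j => (ξ j, u j)) k := by
  induction k with
  | zero => rfl
  | succ k ih => simp only [rsgfSteps, output_bind, ih, output_gradEstimate, output, sgIterate]

lemma calls_rsgfSteps (ξ : ℕ → Ξ) (u : ℕ → (𝔼 n)) (k : ℕ) :
    (rsgfSteps γ μ x₁ ξ u k).calls F = 2 * k := by
  induction k with
  | zero => rfl
  | succ k ih => simp only [rsgfSteps, calls_bind, ih, calls_gradEstimate, calls, mul_add_one]

lemma output_rsgf (ξ : ℕ → Ξ) (u : ℕ → (𝔼 n)) (R : ℕ) :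
    (rsgf γ μ x₁ ξ u R).output F =
      sgIterate γ (twoPointEstimate F μ) x₁ (fun j => (ξ j, u j)) (R - 1) := by
  simp only [rsgf, output_bind, output_rsgfSteps, output]

lemma calls_rsgf (ξ : ℕ → Ξ) (u : ℕ → (𝔼 n)) {R : ℕ} (hR : 1 ≤ R) :
    (rsgf γ μ x₁ ξ u R).calls F = 2 * R := by
  simp only [rsgf, calls_bind, calls_rsgfSteps, calls_gradEstimate, calls]
  omega

lemma calls_twoRSGF_le {S N : ℕ} (T : ℕ) (d : Draws n Ξ Ω) {ω : Ω}
    (pick : (Fin S → (𝔼 n)) → Fin S) (hR : ∀ s < S, d.R s ω ∈ Finset.Icc 1 N) :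
    (twoRSGF γ μ x₁ S T d ω pick).calls F ≤ 2 * S * (N + T) := by
  have hruns : (collect S fun s : Fin S =>
      rsgf γ μ x₁ (fun k => d.ξ s k ω) (fun k => d.u s k ω) (d.R s ω)).calls F ≤ S * (2 * N) := by
    refine calls_collect_le F fun s => ?_
    obtain ⟨hpos, hle⟩ := Finset.mem_Icc.1 (hR s s.2)
    rw [calls_rsgf F γ μ x₁ _ _ hpos]
    exact Nat.mul_le_mul_left 2 hle
  have hestimates := fun x : Fin S → (𝔼 n) => calls_collect_le F (m := S) fun s =>
    calls_avgGradEstimate_le F μ T (x s) (fun k => d.ξ' s k ω) (fun k => d.u' s k ω)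
  simp only [twoRSGF, calls_bind, calls, add_zero]
  exact (add_le_add hruns (hestimates _)).trans_eq (by ring)

/-- The output of the run number `s` of the optimization phase. -/
noncomputable def candidate (d : Draws n Ξ Ω) (s : ℕ) (ω : Ω) : 𝔼 n :=
  sgIterate γ (twoPointEstimate F μ) x₁ (fun j => (d.ξ s j ω, d.u s j ω)) (d.R s ω - 1)

/-- The averaged gradient estimate of the post-optimization phase at the candidate number `s`. -/
noncomputable def candidateEstimate (T : ℕ) (d : Draws n Ξ Ω) (s : ℕ) (ω : Ω) : 𝔼 n :=
  (1 / (T : ℝ)) • ∑ k ∈ Finset.range T,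
    twoPointEstimate F μ (candidate F γ μ x₁ d s ω) (d.ξ' s k ω, d.u' s k ω)

lemma output_twoRSGF {S : ℕ} (T : ℕ) (d : Draws n Ξ Ω) (ω : Ω)
    (pick : (Fin S → (𝔼 n)) → Fin S) :
    (twoRSGF γ μ x₁ S T d ω pick).output F =
      candidate F γ μ x₁ d (pick fun s => candidateEstimate F γ μ x₁ T d s ω) ω := by
  simp only [twoRSGF, output_bind, output_collect, output, output_rsgf, output_avgGradEstimate,
    candidate, candidateEstimate]

end Programs

section Selection

open scoped ENNReal

lemma norm_lt_norm_add_two_mul_of_norm_sub_lt {E : Type*} [SeminormedAddCommGroup E]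
    {v w v' w' : E} {δ : ℝ} (hv : ‖v' - v‖ < δ) (hw : ‖w' - w‖ < δ) (hle : ‖v'‖ ≤ ‖w'‖) :
    ‖v‖ < ‖w‖ + 2 * δ := by
  linarith [norm_le_norm_add_norm_sub v' v, norm_le_norm_add_norm_sub' w' w]

lemma measure_forall_ge_le_pow_of_setLIntegral_le {Ω : Type*} {m : MeasurableSpace Ω}
    {Pr : Measure Ω} {S : ℕ} {𝓕 : ℕ → MeasurableSpace Ω} (h𝓕 : ∀ s, 𝓕 s ≤ m)
    {Y : ℕ → Ω → ℝ≥0∞} (hY : ∀ s ≤ S, ∀ q < s, Measurable[𝓕 s] (Y q)) {β τ : ℝ≥0∞}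
    (hβ : ∀ s < S, ∀ B, MeasurableSet[𝓕 s] B → ∫⁻ ω in B, Y s ω ∂Pr ≤ β * Pr B)
    (hτ : τ ≠ 0) (hτ_top : τ ≠ ∞) :
    Pr {ω | ∀ q < S, τ ≤ Y q ω} ≤ (β / τ) ^ S * Pr Set.univ := by
  suffices ∀ s ≤ S, Pr {ω | ∀ q < s, τ ≤ Y q ω} ≤ (β / τ) ^ s * Pr Set.univ from this S le_rfl
  intro s hs
  induction s with
  | zero => simp
  | succ s ih =>
    have hpast : MeasurableSet[𝓕 s] {ω | ∀ q < s, τ ≤ Y q ω} := by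
      simp only [Set.ofPred_forall]
      exact .iInter fun q => .iInter fun hq =>
        measurableSet_le measurable_const (hY s (Nat.le_of_succ_le hs) q hq)
    have hYs : Measurable (Y s) := (hY (s + 1) hs s s.lt_succ_self).mono (h𝓕 _) le_rfl
    have hsplit : {ω | ∀ q < s + 1, τ ≤ Y q ω} =
        {ω | τ ≤ Y s ω} ∩ {ω | ∀ q < s, τ ≤ Y q ω} := by
      ext ω
      simp only [Nat.forall_lt_succ_right, Set.mem_ofPred_eq, Set.mem_inter_iff, and_comm]
    calc Pr {ω | ∀ q < s + 1, τ ≤ Y q ω}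
        = (Pr.restrict {ω | ∀ q < s, τ ≤ Y q ω}) {ω | τ ≤ Y s ω} := by
          rw [hsplit, Measure.restrict_apply (measurableSet_le measurable_const hYs)]
      _ ≤ (∫⁻ ω in {ω | ∀ q < s, τ ≤ Y q ω}, Y s ω ∂Pr) / τ :=
          meas_ge_le_lintegral_div hYs.aemeasurable hτ hτ_top
      _ ≤ β * ((β / τ) ^ s * Pr Set.univ) / τ := by
          gcongr
          exact (hβ s hs _ hpast).trans (mul_le_mul_right (ih (Nat.le_of_succ_le hs)) β)
      _ = (β / τ) ^ (s + 1) * Pr Set.univ := by simp only [div_eq_mul_inv]; ring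

variable {Ω 𝓐 Z E : Type*} [MeasurableSpace Ω] [m𝓐 : MeasurableSpace 𝓐] [MeasurableSpace Z]
  [StandardBorelSpace Z] [Nonempty Z] [NormedAddCommGroup E] [InnerProductSpace ℝ E]
  [CompleteSpace E] [MeasurableSpace E] [BorelSpace E] [SecondCountableTopology E]
  {g : E → Z → E} {m : E → E} {V : E → ℝ} {A : Ω → 𝓐} {ζ : ℕ → Ω → Z} {K : ℕ} {Pr : Measure Ω}
  [IsFiniteMeasure Pr]

lemma IsEstimatorStream.measure_norm_average_sub_ge_le (hζ : IsEstimatorStream g m V A ζ K Pr)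
    (hg : Measurable (Function.uncurry g)) (hm : Measurable m) {X : Ω → E}
    (hX : Measurable[m𝓐.comap A] X) {v : ℝ}
    (hv : ∫⁻ ω, ENNReal.ofReal (V (X ω)) ∂Pr ≤ ENNReal.ofReal v) (hK : 0 < K) {c : ℝ}
    (hc : 0 < c) :
    Pr {ω | c ≤ ‖(1 / (K : ℝ)) • ∑ k ∈ Finset.range K, g (X ω) (ζ k ω) - m (X ω)‖} ≤
      ENNReal.ofReal (v / (K * c ^ 2)) := by
  have hK' : (0 : ℝ) < K := Nat.cast_pos.2 hK
  have hKc : 0 < (K * c) ^ 2 := by positivity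
  set err := fun ω => ∑ k ∈ Finset.range K, (g (X ω) (ζ k ω) - m (X ω))
  have herr_meas : Measurable err := (measurable_comap_past_sum_sub hg hm hX K).mono
    (measurable_past hζ.measurable_init hζ.measurable_sample K).comap_le le_rfl
  have haverage (ω : Ω) :
      err ω = (K : ℝ) • ((1 / (K : ℝ)) • ∑ k ∈ Finset.range K, g (X ω) (ζ k ω) - m (X ω)) := by
    simp only [err, smul_sub, smul_smul, mul_one_div_cancel hK'.ne', one_smul,
      Finset.sum_sub_distrib, Finset.sum_const, Finset.card_range, Nat.cast_smul_eq_nsmul]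
  calc _ ≤ Pr {ω | ENNReal.ofReal ((K * c) ^ 2) ≤ ENNReal.ofReal (‖err ω‖ ^ 2)} := by
        refine measure_mono fun ω hω => ENNReal.ofReal_le_ofReal ?_
        rw [haverage, norm_smul, Real.norm_of_nonneg hK'.le]
        gcongr
        exact hω
    _ ≤ (∫⁻ ω, ENNReal.ofReal (‖err ω‖ ^ 2) ∂Pr) / ENNReal.ofReal ((K * c) ^ 2) :=
        meas_ge_le_lintegral_div (herr_meas.norm.pow_const 2).ennreal_ofReal.aemeasurable
          (ENNReal.ofReal_pos.2 hKc).ne' ENNReal.ofReal_ne_top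
    _ ≤ K * ENNReal.ofReal v / ENNReal.ofReal ((K * c) ^ 2) := by
        gcongr
        exact (hζ.lintegral_norm_sum_sub_sq_le hg hm hX le_rfl).trans (mul_le_mul_right hv _)
    _ = ENNReal.ofReal (v / (K * c ^ 2)) := by
        rw [← ENNReal.ofReal_natCast, ← ENNReal.ofReal_mul hK'.le, ← ENNReal.ofReal_div_of_pos hKc]
        congr 1
        field_simp

end Selection

lemma measurable_comp_index_of_lt {Ω E : Type*} [MeasurableSpace Ω] [MeasurableSpace E]
    [Nonempty E] {W : ℕ → Ω → E} {N : ℕ} (hW : ∀ k < N, Measurable (W k)) {J : Ω → ℕ}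
    (hJ : Measurable J) (hJ_lt : ∀ ω, J ω < N) : Measurable fun ω => W (J ω) ω := by
  have huncurry : Measurable fun p : ℕ × Ω =>
      if p.1 < N then W p.1 p.2 else Classical.arbitrary E := by
    refine measurable_from_prod_countable_right fun k => ?_
    by_cases hk : k < N
    · simpa only [hk, if_true] using hW k hk
    · simpa only [hk, if_false] using measurable_const
  simpa only [Function.comp_def, hJ_lt, if_true, id_eq] using
    huncurry.comp (hJ.prodMk measurable_id)

section Sampling

variable {n : ℕ}

local notation "𝔼" n => EuclideanSpace ℝ (Fin n)

variable {Ω Ξ : Type*} [MeasurableSpace Ξ] {F : (𝔼 n) → Ξ → ℝ}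

lemma Draws.measurable_comap_runsBefore_candidate (hF : Measurable (Function.uncurry F))
    (γ : ℕ → ℝ) (μ : ℝ) (x₁ : 𝔼 n) (d : Draws n Ξ Ω) {N q s : ℕ} (hqs : q < s)
    (hR : ∀ ω, d.R q ω ∈ Finset.Icc 1 N) :
    Measurable[MeasurableSpace.comap (d.runsBefore N s) inferInstance]
      (candidate F γ μ x₁ d q) := by
  let _ : MeasurableSpace Ω := MeasurableSpace.comap (d.runsBefore N s) inferInstance
  have hrun : Measurable fun ω => d.runsBefore N s ω ⟨q, hqs⟩ :=
    (measurable_pi_apply _).comp (comap_measurable (d.runsBefore N s))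
  have hindex : Measurable fun ω => d.R q ω - 1 :=
    (measurable_from_top (f := fun r : ℕ => r - 1)).comp hrun.snd
  refine measurable_comp_index_of_lt
    (W := fun k ω => sgIterate γ (twoPointEstimate F μ) x₁ (fun j => (d.ξ q j ω, d.u q j ω)) k)
    (fun k hk => ?_) hindex
    (fun ω => Nat.sub_one_lt_of_le (Finset.mem_Icc.1 (hR ω)).1 (Finset.mem_Icc.1 (hR ω)).2)
  refine (measurable_comap_past_sgIterate (A := fun _ : Ω => ()) γ
    (measurable_twoPointEstimate hF μ) x₁ k).mono (Measurable.comap_le ?_) le_rfl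
  exact measurable_const.prodMk (measurable_pi_lambda _ fun j =>
    (measurable_pi_apply (⟨j, j.2.trans hk⟩ : Fin N)).comp hrun.fst)

variable [MeasurableSpace Ω] [StandardBorelSpace Ξ] [Nonempty Ξ] {f : (𝔼 n) → ℝ} {μ L σ : ℝ}
  {Pr : Measure Ω} [IsFiniteMeasure Pr]

lemma isEstimatorStream_twoPointEstimate {𝓐 : Type*} [MeasurableSpace 𝓐] {A : Ω → 𝓐}
    {ξ : ℕ → Ω → Ξ} {u : ℕ → Ω → (𝔼 n)} {K : ℕ} (hF : Measurable (Function.uncurry F))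
    (hμ : 0 < μ) (hA : Measurable A) (hξ : ∀ k, Measurable (ξ k)) (hu : ∀ k, Measurable (u k))
    (horacle : ∀ k < K, ∀ᵐ h ∂(Pr.map (past A (fun j ω => (ξ j ω, u j ω)) k)),
      OracleLaw F f L σ (condDistrib (ξ k) (past A (fun j ω => (ξ j ω, u j ω)) k) Pr h))
    (hgaussian : ∀ k < K, Pr.map (u k) = stdGaussian (𝔼 n))
    (hindep : ∀ k < K,
      IndepFun (u k) (fun ω => (past A (fun j ω => (ξ j ω, u j ω)) k ω, ξ k ω)) Pr) :
    IsEstimatorStream (twoPointEstimate F μ) (smoothedGradient f μ)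
      (fun x => 2 * (n + 4) * ‖gradient f x‖ ^ 2 + noiseLevel n L σ μ) A
      (fun k ω => (ξ k ω, u k ω)) K Pr where
  measurable_init := hA
  measurable_sample k := (hξ k).prodMk (hu k)
  isEstimator k hk := by
    filter_upwards [condDistrib_prodMk_ae_eq_of_indepFun
      (measurable_past hA (fun j => (hξ j).prodMk (hu j)) k) (hξ k) (hu k) (hindep k hk),
      horacle k hk] with h hlaw hQ
    rw [hlaw, Kernel.prod_apply, Kernel.const_apply, hgaussian k hk]
    exact hQ.isEstimator_twoPointEstimate hF hμ

namespace Draws.IsSampling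

variable {γ : ℕ → ℝ} {x₁ : 𝔼 n} {S N T : ℕ} {d : Draws n Ξ Ω}

lemma measurable_runsBefore (hd : d.IsSampling Pr F f L σ γ S N T) (s : ℕ) :
    Measurable (d.runsBefore N s) := by
  refine measurable_pi_lambda _ fun q => Measurable.prodMk (measurable_pi_lambda _ fun j => ?_) ?_
  · exact (hd.measurable_ξ q j).prodMk (hd.measurable_u q j)
  · exact hd.measurable_R q

lemma isEstimatorStream_run (hd : d.IsSampling Pr F f L σ γ S N T)
    (hF : Measurable (Function.uncurry F)) (hμ : 0 < μ) {s : ℕ} (hs : s < S) :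
    IsEstimatorStream (twoPointEstimate F μ) (smoothedGradient f μ)
      (fun x => 2 * (n + 4) * ‖gradient f x‖ ^ 2 + noiseLevel n L σ μ) (d.runsBefore N s)
      (fun k ω => (d.ξ s k ω, d.u s k ω)) N Pr :=
  isEstimatorStream_twoPointEstimate hF hμ (hd.measurable_runsBefore s) (hd.measurable_ξ s)
    (hd.measurable_u s) (hd.oracle s hs) (hd.gaussian s hs) (hd.gaussian_indep s hs)

lemma isEstimatorStream_post (hd : d.IsSampling Pr F f L σ γ S N T)
    (hF : Measurable (Function.uncurry F)) (hμ : 0 < μ) {s : ℕ} (hs : s < S) :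
    IsEstimatorStream (twoPointEstimate F μ) (smoothedGradient f μ)
      (fun x => 2 * (n + 4) * ‖gradient f x‖ ^ 2 + noiseLevel n L σ μ) (d.runsBefore N S)
      (fun k ω => (d.ξ' s k ω, d.u' s k ω)) T Pr :=
  isEstimatorStream_twoPointEstimate hF hμ (hd.measurable_runsBefore S) (hd.measurable_ξ' s)
    (hd.measurable_u' s) (hd.oracle' s hs) (hd.gaussian' s hs) (hd.gaussian_indep' s hs)

end Draws.IsSampling

end Sampling

section CandidateQuality

variable {n : ℕ}

local notation "𝔼" n => EuclideanSpace ℝ (Fin n)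

variable {Ω Ξ : Type*} [MeasurableSpace Ω] [MeasurableSpace Ξ] [StandardBorelSpace Ξ] [Nonempty Ξ]
  {F : (𝔼 n) → Ξ → ℝ} {f : (𝔼 n) → ℝ} {μ L σ D Δ lower : ℝ} {Pr : Measure Ω} [IsFiniteMeasure Pr]
  {γ : ℕ → ℝ} {x₁ : 𝔼 n} {S N T : ℕ} {d : Draws n Ξ Ω}

namespace Draws.IsSampling

lemma measureReal_sub_one_eq (hd : d.IsSampling Pr F f L σ γ S N T) {s k : ℕ} (hs : s < S)
    (hk : k < N) :
    Pr.real {ω | d.R s ω - 1 = k} = descentGain L (2 * (n + 4)) (γ (k + 1)) /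
      ∑ j ∈ Finset.range N, descentGain L (2 * (n + 4)) (γ (j + 1)) := by
  rw [← probR_add_one, ← hd.R_law s hs (k + 1) (Finset.mem_Icc.2 ⟨k.succ_pos, hk⟩)]
  congr 1
  ext ω
  have := (Finset.mem_Icc.1 (hd.R_mem s hs ω)).1
  simp only [Set.mem_ofPred_eq]
  omega

lemma setLIntegral_sq_gradient_candidate_le
    (hd : d.IsSampling Pr F f L σ (stepsize n L σ D N) S N T)
    (hF : Measurable (Function.uncurry F)) (hL : 0 < L) (hσ : 0 ≤ σ) (hD : 0 < D) (hN : 0 < N)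
    (hμ : 0 < μ) (hμΔ : N * smoothingError n L μ ≤ (n + 4) * L ^ 2 * Δ ^ 2 / 8) (hf : IsC11 L f)
    (hf_lower : ∀ x, lower ≤ f x) (hΔ : L * Δ ^ 2 / 2 = f x₁ - lower) {s : ℕ} (hs : s < S)
    {B : Set Ω} (hB : MeasurableSet[MeasurableSpace.comap (d.runsBefore N s) inferInstance] B) :
    ∫⁻ ω in B, ENNReal.ofReal
        (‖gradient f (candidate F (stepsize n L σ D N) μ x₁ d s ω)‖ ^ 2) ∂Pr ≤
      ENNReal.ofReal (L * Bbar n L σ D Δ N) * Pr B := by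
  have hpos (k : ℕ) : 0 < stepsize n L σ D N k := stepsize_pos hL hσ hD hN k
  have hgain (k : ℕ) : 0 < descentGain L (2 * (n + 4)) (stepsize n L σ D N k) :=
    (div_pos (hpos k) four_pos).trans_le (stepsize_div_four_le_descentGain hL hσ hD hN k)
  have hloss (k : ℕ) : 0 ≤ descentLoss L (noiseLevel n L σ μ) (smoothingError n L μ)
      (stepsize n L σ D N k) :=
    descentLoss_nonneg hL.le (noiseLevel_nonneg n L σ μ) (smoothingError_nonneg n L μ) (hpos k).le
  have hrun := (hd.isEstimatorStream_run hF hμ hs).setLIntegral_sq_gradient_random_le hL.le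
    hf.1.continuous.measurable hf.continuous_gradient.measurable hf.le_add hf_lower
    (hf.norm_smoothedGradient_sub_sq_le hμ) (measurable_twoPointEstimate hF μ) x₁
    (fun k => (hpos k).le) (fun k => (hgain k).le) hloss
    (Finset.sum_pos (fun k _ => hgain (k + 1)) (Finset.nonempty_range_iff.2 hN.ne'))
    (J := fun ω => d.R s ω - 1) ((measurable_from_top (f := fun r : ℕ => r - 1)).comp
      (hd.measurable_R s))
    (fun ω => have hR := Finset.mem_Icc.1 (hd.R_mem s hs ω); Nat.sub_one_lt_of_le hR.1 hR.2)
    ((hd.R_indep s hs).comp (measurable_from_top (f := fun r : ℕ => r - 1)) measurable_id)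
    (fun k hk => hd.measureReal_sub_one_eq hs hk) hB
  rw [← hΔ] at hrun
  exact hrun.trans (mul_le_mul_left (ENNReal.ofReal_le_ofReal
    (gap_add_descentLoss_div_descentGain_le hL hσ hD hN hμΔ)) (Pr B))

end Draws.IsSampling

end CandidateQuality

section Tail

variable {n : ℕ}

local notation "𝔼" n => EuclideanSpace ℝ (Fin n)

variable {Ω Ξ : Type*} {F : (𝔼 n) → Ξ → ℝ} {f : (𝔼 n) → ℝ} {μ L σ β c : ℝ} {γ : ℕ → ℝ} {x₁ : 𝔼 n}
  {S N T : ℕ} {d : Draws n Ξ Ω}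

lemma norm_gradient_output_lt (hf : IsC11 L f) (hμ : 0 < μ) {ω : Ω}
    {pick : (Fin S → (𝔼 n)) → Fin S} (hpick : ∀ (g : Fin S → (𝔼 n)) s, ‖g (pick g)‖ ≤ ‖g s‖)
    (hclose : ∀ s : Fin S, ‖candidateEstimate F γ μ x₁ T d s ω -
      smoothedGradient f μ (candidate F γ μ x₁ d s ω)‖ < c)
    {s : ℕ} (hs : s < S) (hgood : ‖gradient f (candidate F γ μ x₁ d s ω)‖ ^ 2 < β) :
    ‖gradient f ((twoRSGF γ μ x₁ S T d ω pick).output F)‖ <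
      √β + 2 * (c + √(smoothingError n L μ)) := by
  have herror (s : Fin S) : ‖candidateEstimate F γ μ x₁ T d s ω -
      gradient f (candidate F γ μ x₁ d s ω)‖ < c + √(smoothingError n L μ) :=
    (norm_sub_le_norm_sub_add_norm_sub _ (smoothedGradient f μ _) _).trans_lt
      (add_lt_add_of_lt_of_le (hclose s)
        (Real.le_sqrt_of_sq_le (hf.norm_smoothedGradient_sub_sq_le hμ _)))
  rw [output_twoRSGF]
  set estimate : Fin S → (𝔼 n) := fun s => candidateEstimate F γ μ x₁ T d s ω
  calc _ < ‖gradient f (candidate F γ μ x₁ d s ω)‖ + 2 * (c + √(smoothingError n L μ)) :=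
        norm_lt_norm_add_two_mul_of_norm_sub_lt (herror (pick estimate)) (herror ⟨s, hs⟩)
          (hpick estimate ⟨s, hs⟩)
    _ ≤ _ := by
        gcongr
        exact Real.le_sqrt_of_sq_le hgood.le

variable [MeasurableSpace Ω] [MeasurableSpace Ξ] [StandardBorelSpace Ξ] [Nonempty Ξ]
  {Pr : Measure Ω} [IsProbabilityMeasure Pr]

namespace Draws.IsSampling

lemma measure_forall_sq_gradient_candidate_ge_le (hd : d.IsSampling Pr F f L σ γ S N T)
    (hF : Measurable (Function.uncurry F)) (hf : IsC11 L f) (hβ : 0 < β)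
    (hcand : ∀ s < S, ∀ B, MeasurableSet[MeasurableSpace.comap (d.runsBefore N s) inferInstance] B →
      ∫⁻ ω in B, ENNReal.ofReal (‖gradient f (candidate F γ μ x₁ d s ω)‖ ^ 2) ∂Pr ≤
        ENNReal.ofReal β * Pr B) :
    Pr {ω | ∀ q < S, 2 * β ≤ ‖gradient f (candidate F γ μ x₁ d q ω)‖ ^ 2} ≤
      ENNReal.ofReal (2 ^ (-(S : ℝ))) := by
  have hratio : ENNReal.ofReal β / ENNReal.ofReal (2 * β) = ENNReal.ofReal 2⁻¹ := by
    rw [← ENNReal.ofReal_div_of_pos (by positivity)]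
    congr 1
    field_simp
  have hpow := measure_forall_ge_le_pow_of_setLIntegral_le (Pr := Pr)
    (fun s => (hd.measurable_runsBefore s).comap_le)
    (fun s hs q hqs => (hf.continuous_gradient.measurable.norm.pow_const 2).ennreal_ofReal.comp
      (d.measurable_comap_runsBefore_candidate hF γ μ x₁ hqs (hd.R_mem q (hqs.trans_le hs))))
    hcand (ENNReal.ofReal_pos.2 (by positivity : 0 < 2 * β)).ne' ENNReal.ofReal_ne_top
  rw [hratio, measure_univ, mul_one, ← ENNReal.ofReal_pow (by positivity), inv_pow] at hpow
  rw [Real.rpow_neg zero_le_two, Real.rpow_natCast]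
  exact (measure_mono fun ω (hω : ∀ q < S, _ ≤ _) q hq =>
    ENNReal.ofReal_le_ofReal (hω q hq)).trans hpow

lemma measure_norm_candidateEstimate_sub_ge_le (hd : d.IsSampling Pr F f L σ γ S N T)
    (hF : Measurable (Function.uncurry F)) (hμ : 0 < μ) (hf : IsC11 L f) (hβ : 0 ≤ β)
    {s : ℕ} (hs : s < S)
    (hcand : ∫⁻ ω, ENNReal.ofReal (‖gradient f (candidate F γ μ x₁ d s ω)‖ ^ 2) ∂Pr ≤
      ENNReal.ofReal β) (hT : 0 < T) (hc : 0 < c) :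
    Pr {ω | c ≤ ‖candidateEstimate F γ μ x₁ T d s ω -
        smoothedGradient f μ (candidate F γ μ x₁ d s ω)‖} ≤
      ENNReal.ofReal ((2 * (n + 4) * β + noiseLevel n L σ μ) / (T * c ^ 2)) := by
  have hcand_meas := d.measurable_comap_runsBefore_candidate hF γ μ x₁ hs (hd.R_mem s hs)
  have hnoise := noiseLevel_nonneg n L σ μ
  refine (hd.isEstimatorStream_post hF hμ hs).measure_norm_average_sub_ge_le
    (measurable_twoPointEstimate hF μ) hf.measurable_smoothedGradient hcand_meas ?_ hT hc
  calc _ = ENNReal.ofReal (2 * (n + 4)) *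
            ∫⁻ ω, ENNReal.ofReal (‖gradient f (candidate F γ μ x₁ d s ω)‖ ^ 2) ∂Pr +
          ENNReal.ofReal (noiseLevel n L σ μ) := by
        simp_rw [ENNReal.ofReal_add (mul_nonneg (by positivity : (0 : ℝ) ≤ 2 * (n + 4))
          (sq_nonneg _)) hnoise, ENNReal.ofReal_mul (by positivity : (0 : ℝ) ≤ 2 * (n + 4))]
        rw [lintegral_add_right _ measurable_const, lintegral_const, measure_univ, mul_one,
          lintegral_const_mul' _ _ ENNReal.ofReal_ne_top]
    _ ≤ ENNReal.ofReal (2 * (n + 4)) * ENNReal.ofReal β +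
          ENNReal.ofReal (noiseLevel n L σ μ) := by gcongr
    _ = _ := by
        rw [← ENNReal.ofReal_mul (by positivity), ← ENNReal.ofReal_add (by positivity) hnoise]

lemma measureReal_norm_gradient_output_ge_le (hd : d.IsSampling Pr F f L σ γ S N T)
    (hF : Measurable (Function.uncurry F)) (hμ : 0 < μ) (hf : IsC11 L f) (hβ : 0 < β)
    (hcand : ∀ s < S, ∀ B, MeasurableSet[MeasurableSpace.comap (d.runsBefore N s) inferInstance] B →
      ∫⁻ ω in B, ENNReal.ofReal (‖gradient f (candidate F γ μ x₁ d s ω)‖ ^ 2) ∂Pr ≤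
        ENNReal.ofReal β * Pr B)
    (hT : 0 < T) {pick : Ω → (Fin S → (𝔼 n)) → Fin S}
    (hpick : IsMinNormPick pick) (hc : 0 < c) :
    Pr.real {ω | √(2 * β) + 2 * (c + √(smoothingError n L μ)) ≤
        ‖gradient f ((twoRSGF γ μ x₁ S T d ω (pick ω)).output F)‖} ≤
      2 ^ (-(S : ℝ)) + S * ((2 * (n + 4) * β + noiseLevel n L σ μ) / (T * c ^ 2)) := by
  have hnoise := noiseLevel_nonneg n L σ μ
  refine ENNReal.toReal_le_of_le_ofReal (by positivity) ?_
  set allBad : Set Ω := {ω | ∀ q < S, 2 * β ≤ ‖gradient f (candidate F γ μ x₁ d q ω)‖ ^ 2}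
  set farEstimate : Fin S → Set Ω := fun s => {ω | c ≤ ‖candidateEstimate F γ μ x₁ T d s ω -
    smoothedGradient f μ (candidate F γ μ x₁ d s ω)‖}
  have hcover : {ω | √(2 * β) + 2 * (c + √(smoothingError n L μ)) ≤
      ‖gradient f ((twoRSGF γ μ x₁ S T d ω (pick ω)).output F)‖} ⊆
      allBad ∪ ⋃ s, farEstimate s := by
    intro ω hω
    by_contra! hnot
    simp only [allBad, farEstimate, Set.mem_union, Set.mem_iUnion, Set.mem_ofPred_eq, not_or,
      not_forall, not_exists, not_le] at hnot
    obtain ⟨⟨s, hs, hgood⟩, hclose⟩ := hnot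
    exact (norm_gradient_output_lt hf hμ (hpick.norm_le ω) hclose hs hgood).not_ge hω
  have hfar (s : Fin S) : Pr (farEstimate s) ≤
      ENNReal.ofReal ((2 * (n + 4) * β + noiseLevel n L σ μ) / (T * c ^ 2)) := by
    have hmean := hcand s s.2 Set.univ .univ
    rw [Measure.restrict_univ, measure_univ, mul_one] at hmean
    exact hd.measure_norm_candidateEstimate_sub_ge_le hF hμ hf hβ.le s.2 hmean hT hc
  calc _ ≤ Pr allBad + ∑ s, Pr (farEstimate s) := (measure_mono hcover).trans <|
        (measure_union_le _ _).trans (add_le_add_right (measure_iUnion_fintype_le _ _) _)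
    _ ≤ ENNReal.ofReal (2 ^ (-(S : ℝ))) + ∑ _s : Fin S,
          ENNReal.ofReal ((2 * (n + 4) * β + noiseLevel n L σ μ) / (T * c ^ 2)) := by
        gcongr with s
        · exact hd.measure_forall_sq_gradient_candidate_ge_le hF hf hβ hcand
        · exact hfar s
    _ = _ := by
        rw [Finset.sum_const, Finset.card_univ, Fintype.card_fin, nsmul_eq_mul,
          ENNReal.ofReal_add (by positivity) (by positivity),
          ENNReal.ofReal_mul (by positivity), ENNReal.ofReal_natCast]

end Draws.IsSampling

end Tail

section Parameters

variable {n N : ℕ} {L σ D μ Δ ε Λ : ℝ}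

lemma mul_Dgap_sq_div_two {f : EuclideanSpace ℝ (Fin n) → ℝ} (hL : 0 < L)
    (hf : BddBelow (Set.range f)) (x₁ : EuclideanSpace ℝ (Fin n)) :
    L * Dgap f L x₁ ^ 2 / 2 = f x₁ - ⨅ x, f x := by
  have hgap : 0 ≤ f x₁ - ⨅ x, f x := sub_nonneg.2 (ciInf_le hf x₁)
  rw [Dgap, Real.sq_sqrt (by positivity)]
  field_simp

lemma pos_and_pos_of_le_div (hμ : 0 < μ) (hμΔ : μ ≤ Δ / (((n : ℝ) + 4) * √(2 * (N : ℝ)))) :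
    0 < N ∧ 0 < Δ := by
  have hquot := hμ.trans_le hμΔ
  constructor
  · refine Nat.pos_of_ne_zero fun hN => hquot.ne' ?_
    rw [hN, Nat.cast_zero, mul_zero, Real.sqrt_zero, mul_zero, div_zero]
  · by_contra! hΔ
    exact hquot.not_ge (div_nonpos_of_nonpos_of_nonneg hΔ (by positivity))

lemma mul_smoothingError_le (hμ : 0 ≤ μ) (hN : 0 < N)
    (hμΔ : μ ≤ Δ / (((n : ℝ) + 4) * √(2 * (N : ℝ)))) :
    N * smoothingError n L μ ≤ (n + 4) * L ^ 2 * Δ ^ 2 / 8 := by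
  have hN' : (0 : ℝ) < N := Nat.cast_pos.2 hN
  rw [le_div_iff₀ (by positivity)] at hμΔ
  have hsqrt : √(2 * (N : ℝ)) ^ 2 = 2 * N := Real.sq_sqrt (by positivity)
  calc N * smoothingError n L μ
      = (n + 4) * L ^ 2 * (μ * ((n + 4) * √(2 * (N : ℝ)))) ^ 2 / 8 := by
        rw [smoothingError, mul_pow, mul_pow, hsqrt]; ring
    _ ≤ _ := by gcongr

lemma smoothingError_le_div_eight (hN : 0 < N)
    (hμ : N * smoothingError n L μ ≤ (n + 4) * L ^ 2 * Δ ^ 2 / 8) :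
    smoothingError n L μ ≤ (n + 4) * L ^ 2 * Δ ^ 2 / N / 8 := by
  rw [div_right_comm, le_div_iff₀ (Nat.cast_pos.2 hN)]
  linarith

lemma mul_add_noiseLevel_le (hN : 0 < N)
    (hμ : N * smoothingError n L μ ≤ (n + 4) * L ^ 2 * Δ ^ 2 / 8) (β : ℝ) :
    2 * (n + 4) * β + noiseLevel n L σ μ ≤
      2 * (n + 4) * (β + (n + 4) * L ^ 2 * Δ ^ 2 / N + σ ^ 2) := by
  have herror := smoothingError_le_div_eight hN hμ
  have hscale : 0 ≤ ((n : ℝ) + 4) * L ^ 2 * Δ ^ 2 / N := by positivity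
  rw [noiseLevel]
  nlinarith [mul_nonneg (n.cast_nonneg (α := ℝ)) hscale]

lemma Bbar_pos (hL : 0 < L) (hσ : 0 ≤ σ) (hD : 0 < D) (hN : 0 < N) (hΔ : 0 < Δ) :
    0 < Bbar n L σ D Δ N := by
  unfold Bbar; positivity

lemma sq_sqrt_add_two_mul_add_le_four {x : ℝ} (hx : 0 ≤ x) (c b : ℝ) :
    (√x + 2 * (c + b)) ^ 2 ≤ 4 * x + 12 * c ^ 2 + 12 * b ^ 2 := by
  nlinarith [Real.sq_sqrt hx, sq_nonneg (3 * √x - 2 * (c + b)), sq_nonneg (c - b)]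

lemma sq_sqrt_add_two_mul_add_le_five_halves {x : ℝ} (hx : 0 ≤ x) (c b : ℝ) :
    (√x + 2 * (c + b)) ^ 2 ≤ 5 / 2 * x + 25 / 3 * c ^ 2 + 100 / 3 * b ^ 2 := by
  nlinarith [Real.sq_sqrt hx, sq_nonneg (3 * √x - 4 * (c + b)), sq_nonneg (c - 4 * b)]

lemma two_rpow_neg_numRuns_le (hΛ : 0 < Λ) : (2 : ℝ) ^ (-(numRuns Λ : ℝ)) ≤ Λ / 2 := by
  calc (2 : ℝ) ^ (-(numRuns Λ : ℝ)) ≤ 2 ^ (-Real.logb 2 (2 / Λ)) :=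
        Real.rpow_le_rpow_of_exponent_le one_le_two (neg_le_neg (Nat.le_ceil _))
    _ = Λ / 2 := by
        rw [Real.rpow_neg zero_le_two, Real.rpow_logb two_pos (by norm_num) (by positivity),
          inv_div]

lemma div_le_of_Nhat_le (hε : 0 < ε) (hN : 0 < N) (h : Nhat n L σ D Δ ε ≤ N) :
    (n + 4) * L ^ 2 * Δ ^ 2 / N ≤ ε / 432 := by
  have hfirst : 12 * ((n : ℝ) + 4) * (6 * L * Δ) ^ 2 / ε ≤ N :=
    (le_max_left _ _).trans (Nat.ceil_le.1 h)
  rw [div_le_iff₀ hε] at hfirst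
  rw [div_le_iff₀ (Nat.cast_pos.2 hN)]
  linarith

lemma mul_Bbar_le_of_Nhat_le (hε : 0 < ε) (hN : 0 < N) (h : Nhat n L σ D Δ ε ≤ N) :
    L * Bbar n L σ D Δ N ≤ ε / 12 := by
  have hsqrt_pos : 0 < √(N : ℝ) := Real.sqrt_pos.2 (Nat.cast_pos.2 hN)
  have hsecond : 72 * L * √((n : ℝ) + 4) * (D + Δ ^ 2 / D) * (σ / ε) ≤ √(N : ℝ) :=
    Real.le_sqrt_of_sq_le ((le_max_right _ _).trans (Nat.ceil_le.1 h))
  calc L * Bbar n L σ D Δ N = 12 * ((n + 4) * L ^ 2 * Δ ^ 2 / N) +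
        72 * L * √((n : ℝ) + 4) * (D + Δ ^ 2 / D) * (σ / ε) / √(N : ℝ) * (ε / 18) := by
        rw [Bbar]
        field_simp
        ring
    _ ≤ 12 * (ε / 432) + 1 * (ε / 18) :=
        add_le_add (mul_le_mul_of_nonneg_left (div_le_of_Nhat_le hε hN h) (by norm_num))
          (mul_le_mul_of_nonneg_right ((div_le_one hsqrt_pos).2 hsecond) (by positivity))
    _ = ε / 12 := by ring

lemma le_of_That_le {T : ℕ} (h : That n σ ε Λ ≤ T) :
    24 * ((n : ℝ) + 4) * ((numRuns Λ : ℝ) + 1) / Λ * max 1 (6 * σ ^ 2 / ε) ≤ T :=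
  Nat.ceil_le.1 h

lemma pos_of_That_le (hΛ : 0 < Λ) {T : ℕ} (h : That n σ ε Λ ≤ T) : 0 < T :=
  Nat.cast_pos.1 <| lt_of_lt_of_le
    (by positivity : 0 < 24 * ((n : ℝ) + 4) * ((numRuns Λ : ℝ) + 1) / Λ * max 1 (6 * σ ^ 2 / ε))
    (le_of_That_le h)

lemma mul_div_le_of_That_le (hε : 0 < ε) (hΛ : 0 < Λ) {T : ℕ} (h : That n σ ε Λ ≤ T) {Y : ℝ}
    (hY : Y ≤ ε / 12 + ε / 432 + σ ^ 2) :
    numRuns Λ * (2 * (n + 4) * Y / (T * (ε / 16))) ≤ Λ / 2 := by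
  have hT : (0 : ℝ) < T := Nat.cast_pos.2 (pos_of_That_le hΛ h)
  set M := max 1 (6 * σ ^ 2 / ε)
  have hM_one : ε ≤ ε * M := le_mul_of_one_le_right hε.le (le_max_left _ _)
  have hM_noise : 6 * σ ^ 2 ≤ M * ε := (div_le_iff₀ hε).1 (le_max_right _ _)
  rw [← mul_div_assoc, div_le_iff₀ (by positivity)]
  calc numRuns Λ * (2 * (n + 4) * Y) ≤ numRuns Λ * (2 * (n + 4) * (3 / 8 * (ε * M))) := by
        gcongr
        linarith
    _ ≤ (numRuns Λ + 1) * (2 * (n + 4) * (3 / 8 * (ε * M))) := by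
        gcongr
        exact le_add_of_nonneg_right zero_le_one
    _ = Λ / 2 * (24 * ((n : ℝ) + 4) * ((numRuns Λ : ℝ) + 1) / Λ * M * (ε / 16)) := by
        field_simp
        ring
    _ ≤ Λ / 2 * (T * (ε / 16)) := by
        gcongr
        exact le_of_That_le h

end Parameters

section Confidence

variable {n : ℕ}

local notation "𝔼" n => EuclideanSpace ℝ (Fin n)

lemma isEpsLamSolution_of_measureReal_ge_le {Ω : Type*} [MeasurableSpace Ω] {Pr : Measure Ω}
    [IsProbabilityMeasure Pr] {f : (𝔼 n) → ℝ} {X : Ω → 𝔼 n} {r ε Λ : ℝ} (hr : r ^ 2 ≤ ε)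
    (h : Pr.real {ω | r ≤ ‖gradient f (X ω)‖} ≤ Λ) : IsEpsLamSolution Pr f ε Λ X := by
  have hcover : Set.univ ⊆
      {ω | ‖gradient f (X ω)‖ ^ 2 ≤ ε} ∪ {ω | r ≤ ‖gradient f (X ω)‖} := fun ω _ =>
    (le_total r ‖gradient f (X ω)‖).elim .inr fun hle =>
      .inl ((pow_le_pow_left₀ (norm_nonneg _) hle 2).trans hr)
  have hsum := (measureReal_mono hcover (measure_ne_top Pr _)).trans
    (measureReal_union_le (μ := Pr) _ _)
  rw [probReal_univ] at hsum
  exact (by linarith : 1 - Λ ≤ Pr.real {ω | ‖gradient f (X ω)‖ ^ 2 ≤ ε})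

variable {Ω Ξ : Type*} [MeasurableSpace Ω] [MeasurableSpace Ξ] [StandardBorelSpace Ξ] [Nonempty Ξ]
  {F : (𝔼 n) → Ξ → ℝ} {f : (𝔼 n) → ℝ} {μ L σ D c : ℝ} {Pr : Measure Ω} [IsProbabilityMeasure Pr]
  {x₁ : 𝔼 n} {S N T : ℕ} {d : Draws n Ξ Ω}

namespace Draws.IsSampling

lemma measureReal_norm_gradient_output_stepsize_ge_le
    (hd : d.IsSampling Pr F f L σ (stepsize n L σ D N) S N T)
    (hF : Measurable (Function.uncurry F)) (hL : 0 < L) (hσ : 0 ≤ σ) (hD : 0 < D) (hμ : 0 < μ)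
    (hμΔ : μ ≤ Dgap f L x₁ / (((n : ℝ) + 4) * √(2 * (N : ℝ)))) (hf : IsC11 L f)
    (hf_bdd : BddBelow (Set.range f)) (hT : 0 < T) {pick : Ω → (Fin S → (𝔼 n)) → Fin S}
    (hpick : IsMinNormPick pick) (hc : 0 < c) :
    Pr.real {ω | √(2 * (L * Bbar n L σ D (Dgap f L x₁) N)) + 2 * (c + √(smoothingError n L μ)) ≤
        ‖gradient f ((twoRSGF (stepsize n L σ D N) μ x₁ S T d ω (pick ω)).output F)‖} ≤
      2 ^ (-(S : ℝ)) + S * (2 * (n + 4) * (L * Bbar n L σ D (Dgap f L x₁) N +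
        (n + 4) * L ^ 2 * Dgap f L x₁ ^ 2 / N + σ ^ 2) / (T * c ^ 2)) := by
  obtain ⟨hN, hΔ⟩ := pos_and_pos_of_le_div hμ hμΔ
  have herror := mul_smoothingError_le (L := L) hμ.le hN hμΔ
  have htail := hd.measureReal_norm_gradient_output_ge_le hF hμ hf
    (mul_pos hL (Bbar_pos hL hσ hD hN hΔ))
    (fun s hs B hB => hd.setLIntegral_sq_gradient_candidate_le hF hL hσ hD hN hμ herror hf
      (ciInf_le hf_bdd) (mul_Dgap_sq_div_two hL hf_bdd x₁) hs hB) hT hpick hc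
  refine htail.trans ?_
  gcongr
  exact mul_add_noiseLevel_le hN herror _

theorem measureReal_sq_gradient_output_ge_le
    (hd : d.IsSampling Pr F f L σ (stepsize n L σ D N) S N T)
    (hF : Measurable (Function.uncurry F)) (hL : 0 < L) (hσ : 0 ≤ σ) (hD : 0 < D) (hμ : 0 < μ)
    (hμΔ : μ ≤ Dgap f L x₁ / (((n : ℝ) + 4) * √(2 * (N : ℝ)))) (hf : IsC11 L f)
    (hf_bdd : BddBelow (Set.range f)) (hT : 0 < T) {pick : Ω → (Fin S → (𝔼 n)) → Fin S}
    (hpick : IsMinNormPick pick) {lam : ℝ} (hlam : 0 < lam) :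
    Pr.real {ω | 8 * L * Bbar n L σ D (Dgap f L x₁) N +
          3 * ((n : ℝ) + 4) * L ^ 2 * Dgap f L x₁ ^ 2 / (2 * N) +
          24 * ((n : ℝ) + 4) * lam / T * (L * Bbar n L σ D (Dgap f L x₁) N +
            ((n : ℝ) + 4) * L ^ 2 * Dgap f L x₁ ^ 2 / N + σ ^ 2) ≤
        ‖gradient f ((twoRSGF (stepsize n L σ D N) μ x₁ S T d ω (pick ω)).output F)‖ ^ 2} ≤
      S / lam + 2 ^ (-(S : ℝ)) := by
  obtain ⟨hN, hΔ⟩ := pos_and_pos_of_le_div hμ hμΔ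
  have hB := mul_pos hL (Bbar_pos (n := n) hL hσ hD hN hΔ)
  have herror := smoothingError_le_div_eight hN (mul_smoothingError_le (L := L) hμ.le hN hμΔ)
  set Y := L * Bbar n L σ D (Dgap f L x₁) N + ((n : ℝ) + 4) * L ^ 2 * Dgap f L x₁ ^ 2 / N + σ ^ 2
  have hY : 0 < Y := by positivity
  have hc : 0 < 2 * (n + 4) * lam / T * Y := by positivity
  have htail := hd.measureReal_norm_gradient_output_stepsize_ge_le hF hL hσ hD hμ hμΔ hf hf_bdd hT
    hpick (Real.sqrt_pos.2 hc)
  have hbudget : (S : ℝ) * (2 * (n + 4) * Y / (T * (2 * (n + 4) * lam / T * Y))) = S / lam := by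
    field_simp
  rw [Real.sq_sqrt hc.le, hbudget, add_comm (2 ^ (-(S : ℝ)))] at htail
  refine (measureReal_mono fun ω hω => ?_).trans htail
  refine le_of_sq_le_sq ?_ (norm_nonneg _)
  refine ((sq_sqrt_add_two_mul_add_le_four (by positivity) _ _).trans ?_).trans hω
  rw [Real.sq_sqrt hc.le, Real.sq_sqrt (smoothingError_nonneg n L μ)]
  have hscale : 3 * ((n : ℝ) + 4) * L ^ 2 * Dgap f L x₁ ^ 2 / (2 * N) =
      12 * ((n + 4) * L ^ 2 * Dgap f L x₁ ^ 2 / N / 8) := by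
    ring
  have hnoise : 24 * ((n : ℝ) + 4) * lam / T * Y = 12 * (2 * (n + 4) * lam / T * Y) := by ring
  linarith

theorem isEpsLamSolution_output {ε Λ : ℝ}
    (hd : d.IsSampling Pr F f L σ (stepsize n L σ D N) (numRuns Λ) N T)
    (hF : Measurable (Function.uncurry F)) (hL : 0 < L) (hσ : 0 ≤ σ) (hD : 0 < D) (hμ : 0 < μ)
    (hμΔ : μ ≤ Dgap f L x₁ / (((n : ℝ) + 4) * √(2 * (N : ℝ)))) (hf : IsC11 L f)
    (hf_bdd : BddBelow (Set.range f)) (hε : 0 < ε) (hΛ : 0 < Λ)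
    (hN_large : Nhat n L σ D (Dgap f L x₁) ε ≤ N) (hT_large : That n σ ε Λ ≤ T)
    {pick : Ω → (Fin (numRuns Λ) → (𝔼 n)) → Fin (numRuns Λ)} (hpick : IsMinNormPick pick) :
    IsEpsLamSolution Pr f ε Λ fun ω =>
      (twoRSGF (stepsize n L σ D N) μ x₁ (numRuns Λ) T d ω (pick ω)).output F := by
  obtain ⟨hN, hΔ⟩ := pos_and_pos_of_le_div hμ hμΔ
  have hB := mul_pos hL (Bbar_pos (n := n) hL hσ hD hN hΔ)
  have herror := smoothingError_le_div_eight hN (mul_smoothingError_le (L := L) hμ.le hN hμΔ)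
  have hbound := mul_Bbar_le_of_Nhat_le hε hN hN_large
  have hscale := div_le_of_Nhat_le hε hN hN_large
  have hc : (√ε / 4) ^ 2 = ε / 16 := by rw [div_pow, Real.sq_sqrt hε.le]; norm_num
  have htail := hd.measureReal_norm_gradient_output_stepsize_ge_le hF hL hσ hD hμ hμΔ hf hf_bdd
    (pos_of_That_le hΛ hT_large) hpick (by positivity : 0 < √ε / 4)
  rw [hc] at htail
  refine isEpsLamSolution_of_measureReal_ge_le ?_ (htail.trans ?_)
  · refine (sq_sqrt_add_two_mul_add_le_five_halves (by positivity) _ _).trans ?_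
    rw [hc, Real.sq_sqrt (smoothingError_nonneg n L μ)]
    linarith
  · have hestimates := mul_div_le_of_That_le hε hΛ hT_large
      (add_le_add_left (add_le_add hbound hscale) (σ ^ 2))
    linarith [two_rpow_neg_numRuns_le hΛ]

end Draws.IsSampling

end Confidence

theorem mainTheorem7 {n : ℕ} {Ξ Ω : Type*}
    [MeasurableSpace Ξ] [StandardBorelSpace Ξ] [Nonempty Ξ]
    [MeasurableSpace Ω] (Pr : Measure Ω) [IsProbabilityMeasure Pr]
    (P : Measure Ξ) [IsProbabilityMeasure P]
    (F : EuclideanSpace ℝ (Fin n) → Ξ → ℝ) (hF : Measurable (Function.uncurry F))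
    (hFint : ∀ x, Integrable (F x) P)
    (L σ D : ℝ) (hL : 0 < L) (hσ : 0 ≤ σ) (hD : 0 < D)
    (hFsmooth : ∀ᵐ ξ ∂P, IsC11 L (fun x => F x ξ))
    (hbdd : BddBelow (Set.range (objective F P)))
    (x₁ : EuclideanSpace ℝ (Fin n)) :
    (∀ (S N T : ℕ), 1 ≤ S → 1 ≤ N → 1 ≤ T →
      ∀ μ : ℝ, 0 < μ → μ ≤ Dgap (objective F P) L x₁ / (((n : ℝ) + 4) * √(2 * (N : ℝ))) →
      ∀ d : Draws n Ξ Ω,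
        d.IsSampling Pr F (objective F P) L σ (stepsize n L σ D N) S N T →
      ∀ pick : Ω → (Fin S → EuclideanSpace ℝ (Fin n)) → Fin S, IsMinNormPick pick →
      ∀ lam : ℝ, 0 < lam →
        Pr.real {ω |
          8 * L * Bbar n L σ D (Dgap (objective F P) L x₁) N
            + 3 * ((n : ℝ) + 4) * L ^ 2 * Dgap (objective F P) L x₁ ^ 2 / (2 * N)
            + 24 * ((n : ℝ) + 4) * lam / T *
              (L * Bbar n L σ D (Dgap (objective F P) L x₁) N
                + ((n : ℝ) + 4) * L ^ 2 * Dgap (objective F P) L x₁ ^ 2 / N + σ ^ 2)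
          ≤ ‖gradient (objective F P)
              ((twoRSGF (stepsize n L σ D N) μ x₁ S T d ω (pick ω)).output F)‖ ^ 2}
          ≤ ((S : ℝ) + 1) / lam + 2 ^ (-(S : ℝ))) ∧
    (∀ ε Λ : ℝ, 0 < ε → 0 < Λ → Λ < 1 →
      ∀ S N T : ℕ, S = numRuns Λ → N = Nhat n L σ D (Dgap (objective F P) L x₁) ε →
        T = That n σ ε Λ →
      ∀ μ : ℝ, 0 < μ → μ ≤ Dgap (objective F P) L x₁ / (((n : ℝ) + 4) * √(2 * (N : ℝ))) →
      ∀ d : Draws n Ξ Ω,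
        d.IsSampling Pr F (objective F P) L σ (stepsize n L σ D N) S N T →
      ∀ pick : Ω → (Fin S → EuclideanSpace ℝ (Fin n)) → Fin S, IsMinNormPick pick →
        IsEpsLamSolution Pr (objective F P) ε Λ
          (fun ω => (twoRSGF (stepsize n L σ D N) μ x₁ S T d ω (pick ω)).output F) ∧
        ∀ ω, (twoRSGF (stepsize n L σ D N) μ x₁ S T d ω (pick ω)).calls F ≤ 2 * S * (N + T)) := by
  have hf : IsC11 L (objective F P) := isC11_objective hFint hFsmooth
  constructor
  · intro S N T _ _ hT μ hμ hμΔ d hd pick hpick lam hlam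
    have htail := hd.measureReal_sq_gradient_output_ge_le hF hL hσ hD hμ hμΔ hf hbdd hT hpick hlam
    refine htail.trans ?_
    gcongr
    exact le_add_of_nonneg_right zero_le_one
  · rintro ε Λ hε hΛ - S N T rfl hN hT μ hμ hμΔ d hd pick hpick
    exact ⟨hd.isEpsLamSolution_output hF hL hσ hD hμ hμΔ hf hbdd hε hΛ hN.ge hT.ge hpick,
      fun ω => calls_twoRSGF_le F (stepsize n L σ D N) μ x₁ T d (pick ω)
        fun s hs => hd.R_mem s hs ω⟩
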